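/- Let $\Phi:\mathbb R\to(0,1)$ be the function with $\Phi'(x)=(4\pi)^{-1/2}e^{-x^2/4}$, $\Phi(-\infty)=0$, $\Phi(\infty)=1$. For a metric space, $d_{W_1}(\mu_1,\mu_2)=\inf_q\int d(x_1,x_2)\,dq(x_1,x_2)\in[0,\infty]$, the infimum being over all couplings $q$ of the Borel probability measures $\mu_1,\mu_2$. A *metric flow over* $I'\subset\mathbb R$ is a set $\mathcal X$ with a time function $\mathfrak t:\mathcal X\to I'$, complete separable metrics $d_t$ on the time-slices $\mathcal X_t=\mathfrak t^{-1}(t)$, $t\in I'$, and Borel probability measures $\nu_{x;s}$ on $\mathcal X_s$ for $x\in\mathcal X$, $s\in I'$, $s\le\mathfrak t(x)$, such that: (i) $\nu_{x;\mathfrak t(x)}=\delta_x$; (ii) for $s<t$ in $I'$, $T\ge0$ and any measurable $u_s:\mathcal X_s\to[0,1]$ which, if $T>0$, has the form $u_s=\Phi\circ f_s$ with $f_s$ a $T^{-1/2}$-Lipschitz function, the function $u_t(x)=\int_{\mathcal X_s}u_s\,d\nu_{x;s}$ on $\mathcal X_t$ is either constant or of the form $\Phi\circ f_t$ with $f_t$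 a $(t-s+T)^{-1/2}$-Lipschitz function; (iii) $\nu_{x;t_1}(S)=\int_{\mathcal X_{t_2}}\nu_{y;t_1}(S)\,d\nu_{x;t_2}(y)$ for all $t_1\le t_2\le t_3$ in $I'$, $x\in\mathcal X_{t_3}$ and Borel sets $S\subset\mathcal X_{t_1}$. Let $I\subset\mathbb R$ be an interval and $J\subset I$ a subset. A *metric flow pair over $I$* is $(\mathcal X,(\mu_t)_{t\in I'})$ where $I'\subset I$, $|I\setminus I'|=0$, $\mathcal X$ is a metric flow over $I'$, and the $\mu_t$ are Borel probability measures on $\mathcal X_t$ with $\operatorname{supp}\mu_t=\mathcal X_t$ and $\mu_s=\int_{\mathcal X_t}\nu_{x;s}\,d\mu_t(x)$ for all $s\le t$ in $I'$. It is *fully defined over $J$* if $J\subset I'$. An *almost always isometry fully defined over $J$* between two such pairs, with time domains $I'^{,1},I'^{,2}$, consists of a set $I'$ with $J\subset I'\subset I'^{,1}\cap I'^{,2}$ and $|I'^{,1}\setminus I'|=|I'^{,2}\setminus I'|=0$ and of bijective isometries $\phi_t:\mathcal X^1_t\to\mathcal X^2_t$, $t\in I'$, with $(\phi_t)_*\mu^1_t=\mu^2_t$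 for $t\in I'$ and $(\phi_s)_*\nu^1_{x;s}=\nu^2_{\phi_t(x);s}$ for all $s\le t$ in $I'$ and $x\in\mathcal X^1_t$. Let $\mathbb F_I^J$ be the set of equivalence classes of metric flow pairs over $I$ that are fully defined over $J$, two pairs being equivalent if there is an almost always isometry between them that is fully defined over $J$. A *correspondence over $I$, fully defined over $J$*, between metric flows $\mathcal X^1,\mathcal X^2$ over $I'^{,1},I'^{,2}$ is a family $\mathfrak C$ of metric spaces $(Z_t,d^Z_t)_{t\in I}$ together with sets $J\subset I''^{,i}\subset I'^{,i}\cap I$ and isometric embeddings $\varphi^i_t:\mathcal X^i_t\to Z_t$, $t\in I''^{,i}$, $i=1,2$. Let $d^{\mathfrak C,J}_{\mathbb F}\in[0,\infty]$ be the infimum of all $r>0$ for which there are a Lebesgue measurable set $E\subset I$ with $|E|\le r^2$ and $J\subset I\setminus E\subset I''^{,1}\cap I''^{,2}$, and couplings $q_t$ between $\mu^1_t,\mu^2_t$, $t\in I\setminus E$, such that for all $s\le t$ in $I\setminus E$ $$\int_{\mathcal X^1_t\times\mathcal X^2_t}d^{Z_s}_{W_1}\big((\varphi^1_s)_*\nu^1_{x^1;s},(\varphi^2_s)_*\nu^2_{x^2;s}\big)\,dq_t(x^1,x^2)\le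 r .$$ Let $d^J_{\mathbb F}$ between two metric flow pairs over $I$ that are fully defined over $J$ be the infimum of $d^{\mathfrak C,J}_{\mathbb F}$ over all correspondences $\mathfrak C$ over $I$, fully defined over $J$, between their flows. **Theorem.** $d^J_{\mathbb F}$ descends to a well-defined function $\mathbb F^J_I\times\mathbb F^J_I\to[0,\infty]$, and $(\mathbb F^J_I,d^J_{\mathbb F})$ is a metric space if infinite distances are allowed: the distance vanishes exactly between equal classes, is symmetric and satisfies the triangle inequality. -/

import Mathlib

open MeasureTheory Set
open scoped ENNReal

universe u

noncomputable section

/-! ### Couplings and the `W₁`-Wasserstein distance -/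

/-- `q` is a coupling between `μ₁` and `μ₂`: a measure on the product with marginals `μ₁`, `μ₂`
(it is a probability measure as soon as `μ₁` is one). -/
def IsCoupling {X₁ X₂ : Type*} [MeasurableSpace X₁] [MeasurableSpace X₂]
    (q : Measure (X₁ × X₂)) (μ₁ : Measure X₁) (μ₂ : Measure X₂) : Prop :=
  q.map Prod.fst = μ₁ ∧ q.map Prod.snd = μ₂

/-- The `W₁`-Wasserstein distance, allowed to be infinite: the infimum of `∫ d(x₁, x₂) dq`
over all couplings `q`. -/
def wassersteinOne {Z : Type*} [MetricSpace Z] [MeasurableSpace Z] [BorelSpace Z]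
    (μ₁ μ₂ : Measure Z) : ℝ≥0∞ :=
  ⨅ (q : Measure (Z × Z)) (_ : IsCoupling q μ₁ μ₂), ∫⁻ z, edist z.1 z.2 ∂q

/-! ### Metric flows -/

/-- The function `Φ : ℝ → (0,1)` with `Φ'(x) = (4π)^{-1/2} exp (-x²/4)` and limits `0` and `1` at
`-∞` and `∞`. -/
def heatPhi (x : ℝ) : ℝ :=
  ∫ y in Iic x, (√(4 * Real.pi))⁻¹ * Real.exp (-y ^ 2 / 4)

/-- A set of points with a time function to `I ⊆ ℝ` and a complete, separable metric on each
time-slice.  (The time-slices at times `t ∉ I` are empty, so that indexing the metrics by all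
real `t` adds no data.) -/
structure TimeSlicedSpace (I : Set ℝ) where
  /-- the set of points -/
  carrier : Type u
  /-- the time function -/
  time : carrier → ℝ
  time_mem : ∀ x, time x ∈ I
  /-- the metrics on the time-slices -/
  metric : ∀ t : ℝ, MetricSpace {x : carrier // time x = t}
  complete : ∀ t : ℝ, CompleteSpace {x : carrier // time x = t}
  separable : ∀ t : ℝ, TopologicalSpace.SeparableSpace {x : carrier // time x = t}

namespace TimeSlicedSpace

variable {I : Set ℝ}

/-- The time-slice at time `t`, the preimage of `t` under the time function. -/
def Slice (X : TimeSlicedSpace.{u} I) (t : ℝ) : Type u := {x : X.carrier // X.time x = t}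

instance (X : TimeSlicedSpace.{u} I) (t : ℝ) : MetricSpace (X.Slice t) := X.metric t

instance (X : TimeSlicedSpace.{u} I) (t : ℝ) : CompleteSpace (X.Slice t) := X.complete t

instance (X : TimeSlicedSpace.{u} I) (t : ℝ) : TopologicalSpace.SeparableSpace (X.Slice t) :=
  X.separable t

instance (X : TimeSlicedSpace.{u} I) (t : ℝ) : MeasurableSpace (X.Slice t) := borel _

instance (X : TimeSlicedSpace.{u} I) (t : ℝ) : BorelSpace (X.Slice t) := ⟨rfl⟩

end TimeSlicedSpace

/-- A metric flow over `I ⊆ ℝ`.  For a point `x` of the time-slice at time `t` and for `s ≤ t`,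
`ν h x` (with `h : s ≤ t`) is the conjugate heat kernel of `x` at time `s`. -/
structure MetricFlow (I : Set ℝ) extends TimeSlicedSpace.{u} I where
  /-- the conjugate heat kernels -/
  ν : ∀ {s t : ℝ}, s ≤ t → toTimeSlicedSpace.Slice t → Measure (toTimeSlicedSpace.Slice s)
  ν_prob : ∀ {s t : ℝ}, s ∈ I → t ∈ I → ∀ (h : s ≤ t) (x : toTimeSlicedSpace.Slice t),
    IsProbabilityMeasure (ν h x)
  ν_self : ∀ {t : ℝ}, t ∈ I → ∀ x : toTimeSlicedSpace.Slice t, ν le_rfl x = Measure.dirac x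
  /-- the gradient property of the heat flow starting at `u` -/
  gradient : ∀ {s t : ℝ}, s ∈ I → t ∈ I → ∀ (h : s < t) (T : ℝ), 0 ≤ T →
    ∀ u : toTimeSlicedSpace.Slice s → ℝ, Measurable u → (∀ y, u y ∈ Icc (0 : ℝ) 1) →
    (0 < T → ∃ f : toTimeSlicedSpace.Slice s → ℝ,
      LipschitzWith (Real.toNNReal (√T)⁻¹) f ∧ ∀ y, u y = heatPhi (f y)) →
    (∃ c : ℝ, ∀ x : toTimeSlicedSpace.Slice t, ∫ y, u y ∂(ν h.le x) = c) ∨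
    (∃ f : toTimeSlicedSpace.Slice t → ℝ,
      LipschitzWith (Real.toNNReal (√(t - s + T))⁻¹) f ∧
        ∀ x : toTimeSlicedSpace.Slice t, ∫ y, u y ∂(ν h.le x) = heatPhi (f x))
  /-- the reproduction formula -/
  reproduction : ∀ {t₁ t₂ t₃ : ℝ}, t₁ ∈ I → t₂ ∈ I → t₃ ∈ I → ∀ (h₁₂ : t₁ ≤ t₂) (h₂₃ : t₂ ≤ t₃)
    (x : toTimeSlicedSpace.Slice t₃) (S : Set (toTimeSlicedSpace.Slice t₁)), MeasurableSet S →
    ν (h₁₂.trans h₂₃) x S = ∫⁻ y, ν h₁₂ y S ∂(ν h₂₃ x)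

/-- A conjugate heat flow `(μ_t)_{t ∈ I}` on a metric flow over `I`. -/
structure MetricFlow.IsConjHeatFlow {I : Set ℝ} (X : MetricFlow.{u} I)
    (μ : ∀ t : ℝ, Measure (X.Slice t)) : Prop where
  prob : ∀ t ∈ I, IsProbabilityMeasure (μ t)
  flow : ∀ {s t : ℝ}, s ∈ I → t ∈ I → ∀ (h : s ≤ t) (S : Set (X.Slice s)), MeasurableSet S →
    μ s S = ∫⁻ x, X.ν h x S ∂(μ t)

/-! ### Metric flow pairs and their equivalence classes -/

/-- A metric flow pair over `I`: a metric flow over a subset `dom ⊆ I` of full measure with a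
conjugate heat flow of full support on it. -/
structure MetricFlowPair (I : Set ℝ) where
  /-- the set of times at which the flow is defined -/
  dom : Set ℝ
  dom_subset : dom ⊆ I
  volume_diff : volume (I \ dom) = 0
  /-- the metric flow -/
  flow : MetricFlow.{u} dom
  /-- the conjugate heat flow -/
  μ : ∀ t : ℝ, Measure (flow.Slice t)
  conj : flow.IsConjHeatFlow μ
  support_eq : ∀ t ∈ dom, (μ t).support = univ

/-- There is an almost always isometry between the metric flow pairs `P₁` and `P₂` that is fully
defined over `J`: a family of isometries between the time-slices at the times of a set
`I' ⊆ P₁.dom ∩ P₂.dom` of full measure that contains `J`, compatible with the conjugate heat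
kernels and with the conjugate heat flows. -/
def AlmostAlwaysIsometric {I : Set ℝ} (J : Set ℝ) (P₁ P₂ : MetricFlowPair.{u} I) : Prop :=
  ∃ I' : Set ℝ, I' ⊆ P₁.dom ∩ P₂.dom ∧ volume (P₁.dom \ I') = 0 ∧ volume (P₂.dom \ I') = 0 ∧
    J ⊆ I' ∧
    ∃ φ : ∀ t : ℝ, t ∈ I' → P₁.flow.Slice t ≃ᵢ P₂.flow.Slice t,
      (∀ (s t : ℝ) (hs : s ∈ I') (ht : t ∈ I') (h : s ≤ t) (x : P₁.flow.Slice t),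
        (P₁.flow.ν h x).map (φ s hs) = P₂.flow.ν h (φ t ht x)) ∧
      ∀ (t : ℝ) (ht : t ∈ I'), (P₁.μ t).map (φ t ht) = P₂.μ t

theorem AlmostAlwaysIsometric.refl {I J : Set ℝ} (P : MetricFlowPair.{u} I) (hJ : J ⊆ P.dom) :
    AlmostAlwaysIsometric J P P :=
  ⟨P.dom, by simp, by simp, by simp, hJ, fun t _ => IsometryEquiv.refl _,
    fun s t hs ht h x => Measure.map_id, fun t ht => Measure.map_id⟩

theorem AlmostAlwaysIsometric.symm {I J : Set ℝ} {P₁ P₂ : MetricFlowPair.{u} I}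
    (h : AlmostAlwaysIsometric J P₁ P₂) : AlmostAlwaysIsometric J P₂ P₁ := by
  obtain ⟨I', hI', h1, h2, hJ, φ, hν, hμ⟩ := h
  refine ⟨I', fun t ht => (hI' ht).symm, h2, h1, hJ, fun t ht => (φ t ht).symm, ?_, ?_⟩
  · intro s t hs ht hst x
    have e := hν s t hs ht hst ((φ t ht).symm x)
    rw [IsometryEquiv.apply_symm_apply] at e
    rw [← e, Measure.map_map (φ s hs).symm.continuous.measurable (φ s hs).continuous.measurable,
      IsometryEquiv.symm_comp_self, Measure.map_id]
  · intro t ht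
    rw [← hμ t ht, Measure.map_map (φ t ht).symm.continuous.measurable
      (φ t ht).continuous.measurable, IsometryEquiv.symm_comp_self, Measure.map_id]

theorem AlmostAlwaysIsometric.trans {I J : Set ℝ} {P₁ P₂ P₃ : MetricFlowPair.{u} I}
    (h : AlmostAlwaysIsometric J P₁ P₂) (h' : AlmostAlwaysIsometric J P₂ P₃) :
    AlmostAlwaysIsometric J P₁ P₃ := by
  obtain ⟨A, hA, h1, h2, hJ, φ, hν, hμ⟩ := h
  obtain ⟨B, hB, h1', h2', hJ', φ', hν', hμ'⟩ := h'
  refine ⟨A ∩ B, fun t ht => ⟨(hA ht.1).1, (hB ht.2).2⟩, ?_, ?_, subset_inter hJ hJ',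
    fun t ht => (φ t ht.1).trans (φ' t ht.2), ?_, ?_⟩
  · refine measure_mono_null (fun t ht => ?_) (measure_union_null h1 h1')
    by_cases hA' : t ∈ A
    · exact Or.inr ⟨(hA hA').2, fun hB' => ht.2 ⟨hA', hB'⟩⟩
    · exact Or.inl ⟨ht.1, hA'⟩
  · refine measure_mono_null (fun t ht => ?_) (measure_union_null h2 h2')
    by_cases hB' : t ∈ B
    · exact Or.inl ⟨(hB hB').1, fun hA' => ht.2 ⟨hA', hB'⟩⟩
    · exact Or.inr ⟨ht.1, hB'⟩
  · intro s t hs ht hst x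
    rw [IsometryEquiv.trans_apply, ← hν' s t hs.2 ht.2 hst, ← hν s t hs.1 ht.1 hst,
      Measure.map_map (φ' s hs.2).continuous.measurable (φ s hs.1).continuous.measurable]
    rfl
  · intro t ht
    rw [← hμ' t ht.2, ← hμ t ht.1,
      Measure.map_map (φ' t ht.2).continuous.measurable (φ t ht.1).continuous.measurable]
    rfl

/-- The metric flow pairs over `I` that are fully defined over `J`. -/
def FullyDefinedPair (I J : Set ℝ) : Type (u + 1) := {P : MetricFlowPair.{u} I // J ⊆ P.dom}

/-- Two metric flow pairs over `I` that are fully defined over `J` are equivalent if there is an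
almost always isometry between them that is fully defined over `J`. -/
instance FullyDefinedPair.setoid (I J : Set ℝ) : Setoid (FullyDefinedPair.{u} I J) where
  r P₁ P₂ := AlmostAlwaysIsometric J P₁.1 P₂.1
  iseqv :=
    { refl := fun P => AlmostAlwaysIsometric.refl P.1 P.2
      symm := fun h => h.symm
      trans := fun h h' => h.trans h' }

/-- The set `𝔽_I^J` of equivalence classes of metric flow pairs over `I` that are fully defined
over `J`. -/
def FSpace (I J : Set ℝ) : Type (u + 1) := Quotient (FullyDefinedPair.setoid.{u} I J)

/-- The class of a metric flow pair in `𝔽_I^J`. -/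
def FSpace.mk {I J : Set ℝ} (P : FullyDefinedPair.{u} I J) : FSpace.{u} I J :=
  Quotient.mk (FullyDefinedPair.setoid.{u} I J) P

/-! ### Correspondences and the `𝔽`-distance -/

/-- A correspondence over `I''` between two metric flows: metric spaces `Z t`, and isometric
embeddings of the time-slices into them that are defined at the times in `dom₁`, `dom₂`
respectively.  (Only the `Z t` with `t ∈ I''` matter.) -/
structure Correspondence {I₁ I₂ : Set ℝ} (X₁ : MetricFlow.{u} I₁) (X₂ : MetricFlow.{u} I₂)
    (I'' : Set ℝ) where
  Z : ℝ → Type u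
  metric : ∀ t, MetricSpace (Z t)
  dom₁ : Set ℝ
  dom₂ : Set ℝ
  dom₁_subset : dom₁ ⊆ I₁ ∩ I''
  dom₂_subset : dom₂ ⊆ I₂ ∩ I''
  φ₁ : ∀ t ∈ dom₁, X₁.Slice t → Z t
  φ₂ : ∀ t ∈ dom₂, X₂.Slice t → Z t
  isometry₁ : ∀ (t : ℝ) (ht : t ∈ dom₁), Isometry (φ₁ t ht)
  isometry₂ : ∀ (t : ℝ) (ht : t ∈ dom₂), Isometry (φ₂ t ht)

namespace Correspondence

variable {I₁ I₂ I'' : Set ℝ} {X₁ : MetricFlow.{u} I₁} {X₂ : MetricFlow.{u} I₂}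

instance (C : Correspondence X₁ X₂ I'') (t : ℝ) : MetricSpace (C.Z t) := C.metric t

instance (C : Correspondence X₁ X₂ I'') (t : ℝ) : MeasurableSpace (C.Z t) := borel _

instance (C : Correspondence X₁ X₂ I'') (t : ℝ) : BorelSpace (C.Z t) := ⟨rfl⟩

/-- The correspondence is fully defined over `J`. -/
def FullyDefined (C : Correspondence X₁ X₂ I'') (J : Set ℝ) : Prop := J ⊆ C.dom₁ ∧ J ⊆ C.dom₂

end Correspondence

/-- `r` is admissible in the definition of the `𝔽`-distance within the correspondence `C`
(uniform over `J`): there are a Lebesgue measurable exceptional set `E ⊆ I''` with `|E| ≤ r²`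
and couplings `q_t` between `μ¹_t` and `μ²_t` at the times `t ∈ I'' \ E` for which all the
integrals `∫ d_{W₁} ((φ¹_s)_* ν¹_{x₁;s}, (φ²_s)_* ν²_{x₂;s}) dq_t (x₁, x₂)`, `s ≤ t`, are at
most `r`. -/
def IsFAdmissible {I₁ I₂ I'' : Set ℝ} (J : Set ℝ) (P₁ : MetricFlowPair.{u} I₁)
    (P₂ : MetricFlowPair.{u} I₂) (C : Correspondence P₁.flow P₂.flow I'') (r : ℝ) : Prop :=
  ∃ E : Set ℝ, E ⊆ I'' ∧ NullMeasurableSet E volume ∧ J ⊆ I'' \ E ∧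
    volume E ≤ ENNReal.ofReal (r ^ 2) ∧
    ∃ (h₁ : I'' \ E ⊆ C.dom₁) (h₂ : I'' \ E ⊆ C.dom₂)
      (q : ∀ t : ℝ, Measure (P₁.flow.Slice t × P₂.flow.Slice t)),
      (∀ t ∈ I'' \ E, IsCoupling (q t) (P₁.μ t) (P₂.μ t)) ∧
      ∀ (s t : ℝ) (hs : s ∈ I'' \ E) (_ : t ∈ I'' \ E) (h : s ≤ t),
        ∫⁻ x, wassersteinOne ((P₁.flow.ν h x.1).map (C.φ₁ s (h₁ hs)))
          ((P₂.flow.ν h x.2).map (C.φ₂ s (h₂ hs))) ∂(q t) ≤ ENNReal.ofReal r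

/-- The `𝔽`-distance between two metric flow pairs within a correspondence, uniform over `J`. -/
def FDistWithin {I₁ I₂ I'' : Set ℝ} (J : Set ℝ) (P₁ : MetricFlowPair.{u} I₁)
    (P₂ : MetricFlowPair.{u} I₂) (C : Correspondence P₁.flow P₂.flow I'') : ℝ≥0∞ :=
  ⨅ (r : ℝ) (_ : 0 < r) (_ : IsFAdmissible J P₁ P₂ C r), ENNReal.ofReal r

/-- The `𝔽`-distance between two metric flow pairs over `I`, uniform over `J`: the infimum of the
`𝔽`-distances within all correspondences over `I` that are fully defined over `J`. -/
def FDist {I : Set ℝ} (J : Set ℝ) (P₁ P₂ : MetricFlowPair.{u} I) : ℝ≥0∞ :=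
  ⨅ (C : Correspondence P₁.flow P₂.flow I) (_ : C.FullyDefined J), FDistWithin J P₁ P₂ C

end

/-! An isometric embedding of two time-slices into a common space `Z` enters the 𝔽-distance only
through the function `c x y = dist (φ x) (ψ y)`. The functions that arise in this way are
characterised by four triangle inequalities (`IsCrossDist`), and the `W₁`-distance of the
pushed-forward kernels is the transport cost for `c` (`wassersteinOne_map_map`). The ambient spaces
can therefore be eliminated (`FDist_eq_iInf`).

Symmetry is then a swap of factors. For the triangle inequality, cross distances are composed by an
infimum over the middle slice (`IsCrossDist.iInf_add`) and couplings are glued along the middle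
marginal. Adding the integrals requires measurability of the integrand. It holds because transport
cost is lower semicontinuous for weak convergence and the heat kernels depend continuously on their
base point.

Distance zero forces isometry by a limit argument. Choose admissible data with `r n < 2⁻ⁿ`. By
Borel–Cantelli, almost every time lies outside `E n` for all large `n`. A nonprincipal ultrafilter
handles all these times at once, without subsequences. Since `μ_t` has full support, small cost
between `μ¹_t` and `μ²_t` gives each `x` a limiting partner `φ_t x` with `c n t x (φ_t x) → 0`;
these partners form an isometry carrying `μ¹_t` to `μ²_t`. The integral bound compares kernels only
at some pairs `(z₁, z₂)`, but such a pair can be found close to `(x, φ_t x)`. The gradient property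
makes kernels at earlier times Lipschitz in total variation, so the comparison passes to `(x, φ_t
x)` itself. -/

noncomputable section

open Filter Topology ProbabilityTheory

/-! ### Cross distances between two metric spaces -/

/-- `c` is the restriction to `X × Y` of a pseudometric on the disjoint union of `X` and `Y` that
extends the given ones. -/
structure IsCrossDist {X Y : Type*} [PseudoMetricSpace X] [PseudoMetricSpace Y]
    (c : X → Y → ℝ) : Prop where
  le_left : ∀ x x' y, c x y ≤ dist x x' + c x' y
  le_right : ∀ x y y', c x y ≤ dist y y' + c x y'
  dist_left : ∀ x x' y, dist x x' ≤ c x y + c x' y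
  dist_right : ∀ x y y', dist y y' ≤ c x y + c x y'

namespace IsCrossDist

variable {X Y Z : Type*} [PseudoMetricSpace X] [PseudoMetricSpace Y] [PseudoMetricSpace Z]
  {c : X → Y → ℝ}

theorem nonneg (h : IsCrossDist c) (x : X) (y : Y) : 0 ≤ c x y := by
  have := h.dist_left x x y
  rw [dist_self] at this
  linarith

theorem flip (h : IsCrossDist c) : IsCrossDist (fun y x => c x y) where
  le_left y y' x := h.le_right x y y'
  le_right y x x' := h.le_left x x' y
  dist_left y y' x := h.dist_right x y y'
  dist_right y x x' := h.dist_left x x' y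

theorem of_isometry {φ : X → Z} {ψ : Y → Z} (hφ : Isometry φ) (hψ : Isometry ψ) :
    IsCrossDist (fun x y => dist (φ x) (ψ y)) where
  le_left x x' y := hφ.dist_eq x x' ▸ dist_triangle _ _ _
  le_right x y y' := by
    rw [← hψ.dist_eq y y', add_comm, dist_comm (ψ y)]
    exact dist_triangle _ _ _
  dist_left x x' y := hφ.dist_eq x x' ▸ dist_triangle_right _ _ _
  dist_right x y y' := hψ.dist_eq y y' ▸ dist_triangle_left _ _ _

theorem continuous (h : IsCrossDist c) : Continuous (fun p : X × Y => c p.1 p.2) := by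
  refine (LipschitzWith.of_le_add_mul 2 fun p q => ?_).continuous
  have h1 := h.le_left p.1 q.1 p.2
  have h2 := h.le_right q.1 p.2 q.2
  have h3 : dist p.1 q.1 ≤ dist p q := le_max_left _ _
  have h4 : dist p.2 q.2 ≤ dist p q := le_max_right _ _
  push_cast
  linarith

/-- Shortest paths through `Y`: this is the distance between `X` and `Z` after gluing `X ⊔ Y` and `Y
⊔ Z` along `Y`. Each inequality is checked before taking infima; two different intermediate points
`y`, `y'` are compared through `dist y y'`. -/
theorem iInf_add {d : Y → Z → ℝ} [Nonempty Y] (h : IsCrossDist c) (h' : IsCrossDist d) :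
    IsCrossDist (fun x z => ⨅ y, (c x y + d y z)) := by
  have bdd : ∀ x z, BddBelow (range fun y => c x y + d y z) := fun x z =>
    ⟨0, forall_mem_range.2 fun y => add_nonneg (h.nonneg _ _) (h'.nonneg _ _)⟩
  refine ⟨fun x x' z => ?_, fun x z z' => ?_, fun x x' z => ?_, fun x z z' => ?_⟩
  · rw [add_comm]
    refine le_ciInf_add fun y => (ciInf_le (bdd x z) y).trans ?_
    linarith [h.le_left x x' y]
  · rw [add_comm]
    refine le_ciInf_add fun y => (ciInf_le (bdd x z) y).trans ?_
    linarith [h'.le_right y z z']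
  · refine le_ciInf_add_ciInf fun y y' => ?_
    have h1 := h'.dist_left y y' z
    have h2 := h.le_right x y' y
    have h3 := h.dist_left x x' y'
    rw [dist_comm] at h2
    linarith
  · refine le_ciInf_add_ciInf fun y y' => ?_
    have h1 := h.dist_right x y y'
    have h2 := h'.le_left y' y z
    have h3 := h'.dist_right y' z z'
    rw [dist_comm] at h2
    linarith

/-- The pseudometric on the disjoint union that a cross distance defines. -/
@[reducible]
def pseudoMetricSpace (h : IsCrossDist c) : PseudoMetricSpace (X ⊕ Y) where
  dist
    | .inl x, .inl x' => dist x x'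
    | .inl x, .inr y => c x y
    | .inr y, .inl x => c x y
    | .inr y, .inr y' => dist y y'
  dist_self := by rintro (x | y) <;> simp
  dist_comm := by rintro (x | y) (x' | y') <;> simp [dist_comm]
  dist_triangle := by
    rintro (x | y) (x' | y') (x'' | y'') <;> simp only
    · exact dist_triangle _ _ _
    · exact h.le_left _ _ _
    · exact h.dist_left _ _ _
    · rw [add_comm, dist_comm]; exact h.le_right _ _ _
    · rw [add_comm, dist_comm]; exact h.le_left _ _ _
    · exact h.dist_right _ _ _
    · exact h.le_right _ _ _
    · exact dist_triangle _ _ _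

end IsCrossDist

theorem IsCrossDist.exists_isometry_pseudoMetricSpace {X Y : Type u} [MetricSpace X]
    [MetricSpace Y] {c : X → Y → ℝ} (h : IsCrossDist c) :
    ∃ (Z : Type u) (_ : PseudoMetricSpace Z) (φ : X → Z) (ψ : Y → Z),
      Isometry φ ∧ Isometry ψ ∧ ∀ x y, dist (φ x) (ψ y) = c x y :=
  ⟨X ⊕ Y, h.pseudoMetricSpace, .inl, .inr,
    @Isometry.of_dist_eq _ _ _ h.pseudoMetricSpace _ fun _ _ => rfl,
    @Isometry.of_dist_eq _ _ _ h.pseudoMetricSpace _ fun _ _ => rfl, fun _ _ => rfl⟩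

/-- Since `c` may vanish, the disjoint union is only pseudometric. Identifying points at distance
zero changes no distances, so both embeddings remain isometric. -/
theorem IsCrossDist.exists_isometry {X Y : Type u} [MetricSpace X] [MetricSpace Y] {c : X → Y → ℝ}
    (h : IsCrossDist c) : ∃ (Z : Type u) (_ : MetricSpace Z) (φ : X → Z) (ψ : Y → Z),
      Isometry φ ∧ Isometry ψ ∧ ∀ x y, dist (φ x) (ψ y) = c x y := by
  obtain ⟨Z, _, φ, ψ, hφ, hψ, hc⟩ := h.exists_isometry_pseudoMetricSpace
  exact ⟨SeparationQuotient Z, inferInstance, fun x => SeparationQuotient.mk (φ x),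
    fun y => SeparationQuotient.mk (ψ y), Isometry.of_dist_eq hφ.dist_eq,
    Isometry.of_dist_eq hψ.dist_eq, hc⟩

/-! ### Couplings and transport costs -/

section Coupling

variable {X Y Z : Type*} [MeasurableSpace X] [MeasurableSpace Y] [MeasurableSpace Z]

theorem IsCoupling.isProbabilityMeasure {q : Measure (X × Y)} {μ : Measure X} {ν : Measure Y}
    (h : IsCoupling q μ ν) [IsProbabilityMeasure μ] : IsProbabilityMeasure q := by
  constructor
  rw [← measure_univ (μ := μ), ← h.1, Measure.map_apply measurable_fst .univ, preimage_univ]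

theorem IsCoupling.swap {q : Measure (X × Y)} {μ : Measure X} {ν : Measure Y}
    (h : IsCoupling q μ ν) : IsCoupling (q.map Prod.swap) ν μ := by
  constructor
  · rw [Measure.map_map measurable_fst measurable_swap]; exact h.2
  · rw [Measure.map_map measurable_snd measurable_swap]; exact h.1

theorem isCoupling_map_graph (μ : Measure X) {f : X → Y} (hf : Measurable f) :
    IsCoupling (μ.map fun x => (x, f x)) μ (μ.map f) := by
  constructor
  · rw [Measure.map_map measurable_fst (by fun_prop)]; exact Measure.map_id
  · rw [Measure.map_map measurable_snd (by fun_prop)]; rfl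

/-- Gluing of two couplings along a common marginal. -/
theorem IsCoupling.exists_glue [StandardBorelSpace Z] {μ₁ : Measure X} {μ₂ : Measure Y}
    {μ₃ : Measure Z} [IsProbabilityMeasure μ₂] {q : Measure (X × Y)} {q' : Measure (Y × Z)}
    (h : IsCoupling q μ₁ μ₂) (h' : IsCoupling q' μ₂ μ₃) :
    ∃ π : Measure ((X × Y) × Z), π.map Prod.fst = q ∧ π.map (fun p => (p.1.2, p.2)) = q' := by
  have : IsProbabilityMeasure q := by
    constructor
    rw [← measure_univ (μ := μ₂), ← h.2, Measure.map_apply measurable_snd .univ, preimage_univ]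
  have : IsProbabilityMeasure q' := h'.isProbabilityMeasure
  have : Nonempty Z := (nonempty_of_isProbabilityMeasure q').map Prod.snd
  let κ : Kernel Y Z := q'.condKernel
  -- Given `(x, y)` drawn from `q`, the point `z` is drawn from the conditional law of `q'` given
  -- `y`, so `x` and `z` are conditionally independent given `y`.
  refine ⟨q ⊗ₘ (κ.comap Prod.snd measurable_snd), Measure.fst_compProd _ _, ?_⟩
  ext S hS
  rw [Measure.map_apply (by fun_prop) hS, Measure.compProd_apply (by measurability)]
  conv_rhs => rw [← q'.disintegrate κ, Measure.compProd_apply hS, Measure.fst, h'.1, ← h.2,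
    lintegral_map (Kernel.measurable_kernel_prodMk_left hS) measurable_snd]
  rfl

/-- The infimum of `∫ c(x, y) dq` over all couplings `q`. -/
def transportCost (c : X → Y → ℝ) (μ : Measure X) (ν : Measure Y) : ℝ≥0∞ :=
  ⨅ (q : Measure (X × Y)) (_ : IsCoupling q μ ν), ∫⁻ z, ENNReal.ofReal (c z.1 z.2) ∂q

theorem transportCost_le {c : X → Y → ℝ} {μ : Measure X} {ν : Measure Y} {q : Measure (X × Y)}
    (h : IsCoupling q μ ν) : transportCost c μ ν ≤ ∫⁻ z, ENNReal.ofReal (c z.1 z.2) ∂q :=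
  iInf₂_le q h

theorem exists_isCoupling_of_transportCost_lt {c : X → Y → ℝ} {μ : Measure X} {ν : Measure Y}
    {r : ℝ≥0∞} (h : transportCost c μ ν < r) :
    ∃ q, IsCoupling q μ ν ∧ ∫⁻ z, ENNReal.ofReal (c z.1 z.2) ∂q < r := by
  simpa only [transportCost, iInf_lt_iff, exists_prop] using h

theorem transportCost_swap_le (c : X → Y → ℝ) (μ : Measure X) (ν : Measure Y) :
    transportCost (fun y x => c x y) ν μ ≤ transportCost c μ ν := by
  refine le_iInf₂ fun q hq => (transportCost_le hq.swap).trans_eq ?_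
  exact MeasurableEquiv.prodComm.measurableEmbedding.lintegral_map _

theorem transportCost_swap (c : X → Y → ℝ) (μ : Measure X) (ν : Measure Y) :
    transportCost (fun y x => c x y) ν μ = transportCost c μ ν :=
  (transportCost_swap_le c μ ν).antisymm (transportCost_swap_le (fun y x => c x y) ν μ)

theorem transportCost_map_eq_zero (μ : Measure X) {f : X → Y} (hf : Measurable f)
    {c : X → Y → ℝ} (hc : ∀ x, c x (f x) = 0) : transportCost c μ (μ.map f) = 0 := by
  refine le_antisymm ((transportCost_le (isCoupling_map_graph μ hf)).trans
    ((lintegral_map_le _ _).trans ?_)) zero_le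
  simp [hc]

theorem transportCost_triangle [StandardBorelSpace Z] {μ₁ : Measure X} {μ₂ : Measure Y}
    {μ₃ : Measure Z} [IsProbabilityMeasure μ₂] {c₁₂ : X → Y → ℝ} {c₂₃ : Y → Z → ℝ} {c₁₃ : X → Z → ℝ}
    (hm : Measurable fun p : X × Y => c₁₂ p.1 p.2) (hm' : Measurable fun p : Y × Z => c₂₃ p.1 p.2)
    (hc : ∀ x y z, c₁₃ x z ≤ c₁₂ x y + c₂₃ y z) :
    transportCost c₁₃ μ₁ μ₃ ≤ transportCost c₁₂ μ₁ μ₂ + transportCost c₂₃ μ₂ μ₃ := by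
  simp only [transportCost, ENNReal.iInf_add, ENNReal.add_iInf]
  refine le_iInf₂ fun q' hq' => le_iInf₂ fun q hq => ?_
  obtain ⟨π, rfl, rfl⟩ := hq.exists_glue hq'
  have key : IsCoupling (π.map fun p => (p.1.1, p.2)) μ₁ μ₃ := by
    constructor
    · rw [← hq.1, Measure.map_map (by fun_prop) (by fun_prop),
        Measure.map_map (by fun_prop) (by fun_prop)]
      rfl
    · rw [← hq'.2, Measure.map_map (by fun_prop) (by fun_prop),
        Measure.map_map (by fun_prop) (by fun_prop)]
      rfl
  refine iInf_le_of_le _ (iInf_le_of_le key ((lintegral_map_le _ _).trans ?_))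
  rw [lintegral_map hm.ennreal_ofReal measurable_fst,
    lintegral_map hm'.ennreal_ofReal (by fun_prop), ← lintegral_add_left (by fun_prop)]
  exact lintegral_mono fun p => (ENNReal.ofReal_le_ofReal (hc _ _ _)).trans ENNReal.ofReal_add_le

/-- The only coupling is the Dirac mass at `(x, y)`. Through this the case `s = t` of the 𝔽-bound
becomes a bound on `∫ c dq_t`. -/
theorem transportCost_dirac_dirac [MeasurableSingletonClass X] [MeasurableSingletonClass Y]
    (c : X → Y → ℝ) (x : X) (y : Y) :
    transportCost c (Measure.dirac x) (Measure.dirac y) = ENNReal.ofReal (c x y) := by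
  refine le_antisymm ?_ (le_iInf₂ fun q hq => ?_)
  · have : IsCoupling (Measure.dirac (x, y)) (Measure.dirac x) (Measure.dirac y) :=
      ⟨Measure.map_dirac' measurable_fst _, Measure.map_dirac' measurable_snd _⟩
    simpa using transportCost_le (c := c) this
  · have hq' : IsProbabilityMeasure q := hq.isProbabilityMeasure
    have h1 : ∀ᵐ z ∂q, z.1 = x := by
      refine ae_of_ae_map measurable_fst.aemeasurable (p := fun a => a = x) ?_
      rw [hq.1, ae_dirac_eq]; exact rfl
    have h2 : ∀ᵐ z ∂q, z.2 = y := by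
      refine ae_of_ae_map measurable_snd.aemeasurable (p := fun a => a = y) ?_
      rw [hq.2, ae_dirac_eq]; exact rfl
    have : ∫⁻ z, ENNReal.ofReal (c z.1 z.2) ∂q = ∫⁻ _, ENNReal.ofReal (c x y) ∂q := by
      refine lintegral_congr_ae ?_
      filter_upwards [h1, h2] with z hz1 hz2
      rw [hz1, hz2]
    rw [this]
    simp

end Coupling

/-- Completeness makes the images closed, so `φ × ψ` is a measurable embedding. A coupling of the
pushforwards is concentrated on the product of the images because its marginals are, and hence pulls
back to a coupling of `μ` and `ν`. No separability or completeness of `Z` is needed. -/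
theorem wassersteinOne_map_map {X Y Z : Type*} [MetricSpace X] [CompleteSpace X]
    [MeasurableSpace X] [BorelSpace X] [MetricSpace Y] [CompleteSpace Y] [MeasurableSpace Y]
    [BorelSpace Y] [MetricSpace Z] [MeasurableSpace Z] [BorelSpace Z] {φ : X → Z} {ψ : Y → Z}
    (hφ : Isometry φ) (hψ : Isometry ψ) (μ : Measure X) (ν : Measure Y) :
    wassersteinOne (μ.map φ) (ν.map ψ) = transportCost (fun x y => dist (φ x) (ψ y)) μ ν := by
  have eφ := hφ.isClosedEmbedding.measurableEmbedding
  have eψ := hψ.isClosedEmbedding.measurableEmbedding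
  have e := eφ.prodMap eψ
  refine le_antisymm (le_iInf₂ fun q hq => ?_) (le_iInf₂ fun q hq => ?_)
  · have : IsCoupling (q.map (Prod.map φ ψ)) (μ.map φ) (ν.map ψ) := by
      rw [← hq.1, ← hq.2]
      constructor
      · rw [Measure.map_map measurable_fst e.measurable,
          Measure.map_map eφ.measurable measurable_fst]; rfl
      · rw [Measure.map_map measurable_snd e.measurable,
          Measure.map_map eψ.measurable measurable_snd]; rfl
    refine iInf_le_of_le _ (iInf_le_of_le this (le_of_eq ?_))
    rw [e.lintegral_map]
    simp only [edist_dist, Prod.map]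
  · have hrange : (q.comap (Prod.map φ ψ)).map (Prod.map φ ψ) = q := by
      rw [e.map_comap, Measure.restrict_eq_self_of_ae_mem]
      have h1 : ∀ᵐ z ∂q, z.1 ∈ range φ := by
        refine ae_of_ae_map measurable_fst.aemeasurable (p := fun a => a ∈ range φ) ?_
        rw [hq.1]
        exact (ae_map_iff eφ.measurable.aemeasurable eφ.measurableSet_range).2
          (ae_of_all _ fun x => mem_range_self x)
      have h2 : ∀ᵐ z ∂q, z.2 ∈ range ψ := by
        refine ae_of_ae_map measurable_snd.aemeasurable (p := fun a => a ∈ range ψ) ?_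
        rw [hq.2]
        exact (ae_map_iff eψ.measurable.aemeasurable eψ.measurableSet_range).2
          (ae_of_all _ fun x => mem_range_self x)
      filter_upwards [h1, h2] with z hz1 hz2
      rw [range_prodMap]
      exact ⟨hz1, hz2⟩
    have : IsCoupling (q.comap (Prod.map φ ψ)) μ ν := by
      constructor
      · apply eφ.map_injective
        rw [← hq.1, Measure.map_map eφ.measurable measurable_fst]
        conv_rhs => rw [← hrange, Measure.map_map measurable_fst e.measurable]
        rfl
      · apply eψ.map_injective
        rw [← hq.2, Measure.map_map eψ.measurable measurable_snd]
        conv_rhs => rw [← hrange, Measure.map_map measurable_snd e.measurable]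
        rfl
    refine (transportCost_le this).trans_eq ?_
    conv_rhs => rw [← hrange, e.lintegral_map]
    simp only [edist_dist, Prod.map]

/-! ### Tightness and semicontinuity of transport cost -/

theorem isTightMeasureSet_range_of_tendsto {X : Type*} [MetricSpace X] [CompleteSpace X]
    [SecondCountableTopology X] [MeasurableSpace X] [BorelSpace X] {a : ℕ → ProbabilityMeasure X}
    {a₀ : ProbabilityMeasure X} (ha : Tendsto a atTop (𝓝 a₀)) :
    IsTightMeasureSet {x | ∃ μ ∈ range a, ((μ : ProbabilityMeasure X) : Measure X) = x} :=
  isTightMeasureSet_of_isCompact_closure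
    (ha.isCompact_insert_range.closure_of_subset (subset_insert _ _))

/-- Near-optimal couplings of weakly convergent marginals are tight, so by Prokhorov a subsequence
converges. The limit couples the limit marginals, and its cost is bounded by the portmanteau form of
Fatou's lemma. -/
theorem lowerSemicontinuous_transportCost {X Y : Type*} [MetricSpace X] [CompleteSpace X]
    [SecondCountableTopology X] [MeasurableSpace X] [BorelSpace X] [MetricSpace Y]
    [CompleteSpace Y] [SecondCountableTopology Y] [MeasurableSpace Y] [BorelSpace Y]
    {c : X → Y → ℝ} (hc : Continuous fun p : X × Y => c p.1 p.2) (hc0 : ∀ x y, 0 ≤ c x y) :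
    LowerSemicontinuous fun p : ProbabilityMeasure X × ProbabilityMeasure Y =>
      transportCost c (p.1 : Measure X) (p.2 : Measure Y) := by
  rw [lowerSemicontinuous_iff_isClosed_preimage]
  intro r
  rcases eq_or_ne r ∞ with rfl | hr
  · simp
  refine IsSeqClosed.isClosed fun p p₀ hp hlim => ?_
  -- Optimal couplings are avoided by allowing slack `1 / n`; at `n = 0` the slack is `∞`, which is
  -- harmless.
  have hex : ∀ n, ∃ q : ProbabilityMeasure (X × Y),
      IsCoupling (q : Measure (X × Y)) (p n).1 (p n).2 ∧
      ∫⁻ z, ENNReal.ofReal (c z.1 z.2) ∂(q : Measure (X × Y)) ≤ r + (n : ℝ≥0∞)⁻¹ := by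
    intro n
    obtain ⟨q, hq, hqr⟩ := exists_isCoupling_of_transportCost_lt
      ((hp n).trans_lt (ENNReal.lt_add_right hr (ENNReal.inv_ne_zero.2 (ENNReal.natCast_ne_top n))))
    exact ⟨⟨q, hq.isProbabilityMeasure⟩, hq, hqr.le⟩
  choose q hq hqr using hex
  have hlim1 : Tendsto (fun n => (p n).1) atTop (𝓝 p₀.1) := (continuous_fst.tendsto _).comp hlim
  have hlim2 : Tendsto (fun n => (p n).2) atTop (𝓝 p₀.2) := (continuous_snd.tendsto _).comp hlim
  have htight : IsTightMeasureSet
      {x | ∃ μ ∈ range q, ((μ : ProbabilityMeasure (X × Y)) : Measure (X × Y)) = x} := by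
    refine IsTightMeasureSet.prodMk ((isTightMeasureSet_range_of_tendsto hlim1).subset ?_)
      ((isTightMeasureSet_range_of_tendsto hlim2).subset ?_)
    · rintro _ ⟨_, ⟨_, ⟨n, rfl⟩, rfl⟩, rfl⟩
      exact ⟨_, ⟨n, rfl⟩, (hq n).1.symm⟩
    · rintro _ ⟨_, ⟨_, ⟨n, rfl⟩, rfl⟩, rfl⟩
      exact ⟨_, ⟨n, rfl⟩, (hq n).2.symm⟩
  obtain ⟨q₀, -, θ, hθ, hqlim⟩ := (isCompact_closure_of_isTightMeasureSet htight).isSeqCompact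
    fun n => subset_closure (mem_range_self n)
  have hcoup : IsCoupling (q₀ : Measure (X × Y)) p₀.1 p₀.2 := by
    constructor
    · have h1 := ProbabilityMeasure.tendsto_map_of_tendsto_of_continuous _ _ hqlim
        (f := Prod.fst) continuous_fst
      have h2 : (fun n => ((q ∘ θ) n).map (f := Prod.fst) continuous_fst.measurable.aemeasurable) =
          fun n => (p (θ n)).1 := funext fun n => Subtype.ext (hq (θ n)).1
      rw [h2] at h1
      exact congrArg ProbabilityMeasure.toMeasure
        (tendsto_nhds_unique h1 (hlim1.comp hθ.tendsto_atTop))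
    · have h1 := ProbabilityMeasure.tendsto_map_of_tendsto_of_continuous _ _ hqlim
        (f := Prod.snd) continuous_snd
      have h2 : (fun n => ((q ∘ θ) n).map (f := Prod.snd) continuous_snd.measurable.aemeasurable) =
          fun n => (p (θ n)).2 := funext fun n => Subtype.ext (hq (θ n)).2
      rw [h2] at h1
      exact congrArg ProbabilityMeasure.toMeasure
        (tendsto_nhds_unique h1 (hlim2.comp hθ.tendsto_atTop))
  refine (transportCost_le hcoup).trans
    ((lintegral_le_liminf_lintegral_of_forall_isOpen_measure_le_liminf_measure hc
      (fun z => hc0 z.1 z.2) fun G hG =>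
        ProbabilityMeasure.le_liminf_measure_open_of_tendsto hqlim hG).trans ?_)
  have hr' : Tendsto (fun n => r + ((θ n : ℕ) : ℝ≥0∞)⁻¹) atTop (𝓝 r) := by
    have := (ENNReal.tendsto_inv_nat_nhds_zero.comp hθ.tendsto_atTop).const_add r
    rwa [add_zero] at this
  exact (liminf_le_liminf (Eventually.of_forall fun n => hqr (θ n))).trans_eq hr'.liminf_eq

/-! ### Limits along ultrafilters -/

/-- Markov's inequality: at most mass `r / η` is transported at cost `η` or more. -/
theorem IsCoupling.measure_le_add {X Y : Type*} [MeasurableSpace X] [MeasurableSpace Y]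
    {q : Measure (X × Y)} {μ : Measure X} {ν : Measure Y} (hq : IsCoupling q μ ν) {c : X → Y → ℝ}
    (hc : Measurable fun p : X × Y => c p.1 p.2) {r η : ℝ} (hη : 0 < η)
    (hr : ∫⁻ z, ENNReal.ofReal (c z.1 z.2) ∂q ≤ ENNReal.ofReal r) {S : Set X}
    (hS : MeasurableSet S) :
    μ S ≤ q {z | z.1 ∈ S ∧ c z.1 z.2 < η} + ENNReal.ofReal (r / η) := by
  have hη' : ENNReal.ofReal η ≠ 0 := by simpa using hη
  rw [← hq.1, Measure.map_apply measurable_fst hS]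
  have hsub : Prod.fst ⁻¹' S ⊆ {z : X × Y | z.1 ∈ S ∧ c z.1 z.2 < η} ∪
      {z | ENNReal.ofReal η ≤ ENNReal.ofReal (c z.1 z.2)} := by
    intro z hz
    rcases lt_or_ge (c z.1 z.2) η with h | h
    · exact Or.inl ⟨hz, h⟩
    · exact Or.inr (ENNReal.ofReal_le_ofReal h)
  refine (measure_mono hsub).trans ((measure_union_le _ _).trans (add_le_add le_rfl ?_))
  refine (meas_ge_le_lintegral_div hc.ennreal_ofReal.aemeasurable hη' ENNReal.ofReal_ne_top).trans ?_
  rw [ENNReal.ofReal_div_of_pos hη]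
  gcongr

theorem measure_ball_pos_of_support_eq_univ {X : Type*} [PseudoMetricSpace X] [MeasurableSpace X]
    {μ : Measure X} (h : μ.support = univ) (x : X) {η : ℝ} (hη : 0 < η) :
    0 < μ (Metric.ball x η) := by
  have hx : x ∈ μ.support := h ▸ mem_univ x
  obtain ⟨u, hu, hsub⟩ := ((Measure.mem_support_iff.1 hx).and_eventually
    (eventually_smallSets_subset.2 (Metric.ball_mem_nhds x hη))).exists
  exact hu.trans_le (measure_mono hsub)

section Ultralimit

variable {ι : Type*} {ω : Ultrafilter ι}

section

variable {X Y : Type*} [MetricSpace X] [MetricSpace Y] {c : ι → X → Y → ℝ}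

/-- If the costs of `(x, y)` and `(x', y')` both tend to zero, the cross-distance inequalities force
`dist x x' = dist y y'`. So partners are unique, and the choices in the two directions are mutually
inverse isometries. -/
theorem exists_isometryEquiv_of_exists_tendsto_zero (hc : ∀ᶠ i in ω, IsCrossDist (c i))
    (h : ∀ x, ∃ y, Tendsto (fun i => c i x y) ω (𝓝 0))
    (h' : ∀ y, ∃ x, Tendsto (fun i => c i x y) ω (𝓝 0)) :
    ∃ φ : X ≃ᵢ Y, ∀ x, Tendsto (fun i => c i x (φ x)) ω (𝓝 0) := by
  choose f hf using h
  choose g hg using h'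
  have key : ∀ {x x' y y'}, Tendsto (fun i => c i x y) ω (𝓝 0) →
      Tendsto (fun i => c i x' y') ω (𝓝 0) → dist x x' = dist y y' := by
    intro x x' y y' h1 h2
    apply le_antisymm
    · refine ge_of_tendsto (f := fun i => c i x y + c i x' y' + dist y y') (x := (ω : Filter ι))
        (by simpa using (h1.add h2).add_const (dist y y')) ?_
      filter_upwards [hc] with i hi
      linarith [hi.dist_left x x' y, hi.le_right x' y y']
    · refine ge_of_tendsto (f := fun i => c i x y + c i x' y' + dist x x') (x := (ω : Filter ι))
        (by simpa using (h1.add h2).add_const (dist x x')) ?_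
      filter_upwards [hc] with i hi
      linarith [hi.dist_right x y y', hi.le_left x x' y']
  have hfg : ∀ y, f (g y) = y := fun y => by
    rw [← dist_eq_zero, ← key (hf (g y)) (hg y), dist_self]
  exact ⟨IsometryEquiv.mk' f g hfg (Isometry.of_dist_eq fun x x' => (key (hf x) (hf x')).symm), hf⟩

/-- The function `x ↦ c i x (φ x)` is 2-Lipschitz because `φ` is an isometry, so smallness on a
finite `η / 4`-net suffices. -/
theorem eventually_forall_mem_compact_lt (hc : ∀ᶠ i in ω, IsCrossDist (c i)) (φ : X ≃ᵢ Y)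
    (hφ : ∀ x, Tendsto (fun i => c i x (φ x)) ω (𝓝 0)) {K : Set X} (hK : IsCompact K) {η : ℝ}
    (hη : 0 < η) : ∀ᶠ i in ω, ∀ x ∈ K, c i x (φ x) < η := by
  obtain ⟨t, -, htf, htK⟩ := hK.finite_cover_balls (e := η / 4) (by positivity)
  have hnet : ∀ᶠ i in ω, ∀ x ∈ t, c i x (φ x) < η / 4 :=
    (eventually_all_finite htf).2 fun x _ => (hφ x).eventually_lt_const (by positivity)
  filter_upwards [hc, hnet] with i hci hi x hx
  obtain ⟨z, hz, hxz⟩ := mem_iUnion₂.1 (htK hx)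
  rw [Metric.mem_ball] at hxz
  have h1 := hci.le_left x z (φ x)
  have h2 := hci.le_right z (φ x) (φ z)
  rw [φ.dist_eq] at h2
  linarith [hi z hz]

end

variable {X Y : Type*} [MetricSpace X] [MeasurableSpace X] [BorelSpace X] [MetricSpace Y]
    [MeasurableSpace Y] [BorelSpace Y] {c : ι → X → Y → ℝ}

/-- The ball of radius `η` about `x` has mass `m > 0`, and a compact `K` misses at most `m / 4` of
`ν`. Once the cost is below `η * (m / 4)`, at most `m / 4` moves by `η` or more. Some mass of the
ball therefore lands in `K` at cost below `η`, which gives a point of `K` within `2 * η` of `x`.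
These points depend on `i`, and compactness supplies a limit along `ω`. -/
theorem exists_eventually_le_of_transportCost [CompleteSpace Y] [SecondCountableTopology Y]
    (hc : ∀ᶠ i in ω, IsCrossDist (c i)) {μ : Measure X}
    {ν : Measure Y} [IsProbabilityMeasure μ] [IsProbabilityMeasure ν] (hμ : μ.support = univ)
    (h : ∀ ε : ℝ, 0 < ε → ∀ᶠ i in ω, transportCost (c i) μ ν < ENNReal.ofReal ε) (x : X) {ε : ℝ}
    (hε : 0 < ε) : ∃ y, ∀ᶠ i in ω, c i x y ≤ ε := by
  set η := ε / 3 with hη_def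
  have hη : 0 < η := by positivity
  have hm := measure_ball_pos_of_support_eq_univ hμ x hη
  set m := μ.real (Metric.ball x η) with hm_def
  have hm_eq : μ (Metric.ball x η) = ENNReal.ofReal m := (ofReal_measureReal).symm
  have hm0 : 0 < m := by rw [hm_eq] at hm; simpa using hm
  obtain ⟨K, hK, hKν⟩ := isTightMeasureSet_iff_exists_isCompact_measure_compl_le.1
    (isTightMeasureSet_singleton (μ := ν)) (ENNReal.ofReal (m / 4)) (by simpa using by positivity)
  have hex : ∀ᶠ i in ω, ∃ y ∈ K, c i x y ≤ 2 * η := by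
    filter_upwards [hc, h (η * (m / 4)) (by positivity)] with i hci hi
    obtain ⟨q, hq, hqi⟩ := exists_isCoupling_of_transportCost_lt hi
    have h1 := hq.measure_le_add hci.continuous.measurable hη hqi.le
      (measurableSet_ball (x := x) (ε := η))
    by_contra! hcon
    have hsub : {z : X × Y | z.1 ∈ Metric.ball x η ∧ c i z.1 z.2 < η} ⊆ Prod.snd ⁻¹' Kᶜ := by
      rintro z ⟨hz1, hz2⟩ hzK
      have h2 := hcon z.2 hzK
      have h3 := hci.le_left x z.1 z.2
      rw [Metric.mem_ball, dist_comm] at hz1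
      linarith
    have h2 : q (Prod.snd ⁻¹' Kᶜ) ≤ ENNReal.ofReal (m / 4) := by
      rw [← Measure.map_apply measurable_snd hK.measurableSet.compl, hq.2]
      exact hKν ν rfl
    have h3 := h1.trans (add_le_add ((measure_mono hsub).trans h2) le_rfl)
    rw [hm_eq, mul_div_cancel_left₀ _ hη.ne', ← ENNReal.ofReal_add (by positivity) (by positivity),
      ENNReal.ofReal_le_ofReal_iff (by positivity)] at h3
    linarith
  obtain ⟨y₁, hy₁⟩ : ∃ y, y ∈ K := by
    obtain ⟨i, y, hy, -⟩ := hex.exists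
    exact ⟨y, hy⟩
  -- A choice in `K` at every index, with default `y₁` at the negligible ones, so that the
  -- ultrafilter can be pushed forward to `K`.
  have hex' : ∀ i, ∃ y ∈ K, (∃ y ∈ K, c i x y ≤ 2 * η) → c i x y ≤ 2 * η := by
    intro i
    by_cases hi : ∃ y ∈ K, c i x y ≤ 2 * η
    · obtain ⟨y, hy, hy'⟩ := hi
      exact ⟨y, hy, fun _ => hy'⟩
    · exact ⟨y₁, hy₁, fun hi' => absurd hi' hi⟩
  choose y hyK hy using hex'
  obtain ⟨y₀, -, hlim⟩ := hK.ultrafilter_le_nhds (ω.map y)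
    (le_principal_iff.2 (Eventually.of_forall (p := fun i => y i ∈ K) hyK))
  refine ⟨y₀, ?_⟩
  have hlim' : Tendsto y ω (𝓝 y₀) := hlim
  filter_upwards [hc, hex, hlim' (Metric.ball_mem_nhds y₀ hη)] with i hci hi hyi
  have h1 := hci.le_right x y₀ (y i)
  have h2 := hy i hi
  rw [mem_preimage, Metric.mem_ball, dist_comm] at hyi
  linarith

/-- Partners `y n` with error `1 / (n + 1)` form a Cauchy sequence: at a common index, `y n` and `y
k` are both close to `x`. Completeness gives an exact partner. -/
theorem exists_tendsto_zero_of_transportCost [CompleteSpace Y] [SecondCountableTopology Y]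
    (hc : ∀ᶠ i in ω, IsCrossDist (c i)) {μ : Measure X}
    {ν : Measure Y} [IsProbabilityMeasure μ] [IsProbabilityMeasure ν] (hμ : μ.support = univ)
    (h : ∀ ε : ℝ, 0 < ε → ∀ᶠ i in ω, transportCost (c i) μ ν < ENNReal.ofReal ε) (x : X) :
    ∃ y, Tendsto (fun i => c i x y) ω (𝓝 0) := by
  have hex : ∀ n : ℕ, ∃ y, ∀ᶠ i in ω, c i x y ≤ 1 / ((n : ℝ) + 1) := fun n =>
    exists_eventually_le_of_transportCost hc hμ h x Nat.one_div_pos_of_nat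
  choose y hy using hex
  have hlim0 := tendsto_one_div_add_atTop_nhds_zero_nat (𝕜 := ℝ)
  have hcauchy : CauchySeq y := by
    refine cauchySeq_of_le_tendsto_0 (fun n => 2 * (1 / ((n : ℝ) + 1))) (fun n k N hn hk => ?_)
      (by simpa using hlim0.const_mul 2)
    obtain ⟨i, hci, h1, h2⟩ := (hc.and ((hy n).and (hy k))).exists
    have h3 := hci.dist_right x (y n) (y k)
    have h4 : 1 / ((n : ℝ) + 1) ≤ 1 / ((N : ℝ) + 1) := Nat.one_div_le_one_div hn
    have h5 : 1 / ((k : ℝ) + 1) ≤ 1 / ((N : ℝ) + 1) := Nat.one_div_le_one_div hk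
    linarith
  obtain ⟨y₀, hy₀⟩ := cauchySeq_tendsto_of_complete hcauchy
  refine ⟨y₀, Metric.tendsto_nhds.2 fun ε hε => ?_⟩
  obtain ⟨n, hn1, hn2⟩ := ((hlim0.eventually_lt_const (half_pos hε)).and
    (hy₀ (Metric.ball_mem_nhds y₀ (half_pos hε)))).exists
  filter_upwards [hc, hy n] with i hci hi
  have h1 := hci.le_right x y₀ (y n)
  rw [Metric.mem_ball, dist_comm] at hn2
  rw [Real.dist_eq, sub_zero, abs_of_nonneg (hci.nonneg _ _)]
  linarith

/-- The auxiliary `a'` and `b'` allow for kernels that are compared only at nearby base points. The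
error `ε` has five equal parts: replacing `b` by `b'`, the mass moved by `δ / 2` or more, replacing
`a'` by `a` on the thickening and again on `Kᶜ`, and `a Kᶜ`. On the compact `K` the convergence `c i
x (φ x) → 0` is uniform, which puts `φ x` within `δ` of `F`. -/
theorem measure_le_map_thickening [CompleteSpace X] [SecondCountableTopology X]
    (hc : ∀ᶠ i in ω, IsCrossDist (c i)) (φ : X ≃ᵢ Y)
    (hφ : ∀ x, Tendsto (fun i => c i x (φ x)) ω (𝓝 0)) {a : Measure X} {b : Measure Y}
    [IsProbabilityMeasure a]
    (h : ∀ ε : ℝ, 0 < ε → ∀ᶠ i in ω, ∃ (a' : Measure X) (b' : Measure Y),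
      (∀ S, MeasurableSet S → a' S ≤ a S + ENNReal.ofReal ε) ∧
      (∀ S, MeasurableSet S → b S ≤ b' S + ENNReal.ofReal ε) ∧
      transportCost (c i) a' b' < ENNReal.ofReal ε) {F : Set Y} (hF : MeasurableSet F) {δ ε : ℝ}
    (hδ : 0 < δ) (hε : 0 < ε) :
    b F ≤ a.map φ (Metric.thickening δ F) + ENNReal.ofReal ε := by
  obtain ⟨K, hK, hKa⟩ := isTightMeasureSet_iff_exists_isCompact_measure_compl_le.1
    (isTightMeasureSet_singleton (μ := a)) (ENNReal.ofReal (ε / 5)) (by simpa using hε)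
  obtain ⟨i, hci, hi, hiK⟩ := (hc.and ((h (min (ε / 5) (δ / 2 * (ε / 5))) (by positivity)).and
    (eventually_forall_mem_compact_lt hc φ hφ hK (half_pos hδ)))).exists
  obtain ⟨a', b', ha, hb, hab⟩ := hi
  obtain ⟨q, hq, hqi⟩ := exists_isCoupling_of_transportCost_lt hab
  have hmin : ENNReal.ofReal (min (ε / 5) (δ / 2 * (ε / 5))) ≤ ENNReal.ofReal (ε / 5) :=
    ENNReal.ofReal_le_ofReal (min_le_left _ _)
  have h1 := hq.swap.measure_le_add (c := fun y x => c i x y) hci.flip.continuous.measurable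
    (half_pos hδ) (r := δ / 2 * (ε / 5)) (S := F) (by
      rw [show (Prod.swap : X × Y → Y × X) = MeasurableEquiv.prodComm from rfl,
        MeasurableEquiv.prodComm.measurableEmbedding.lintegral_map]
      exact hqi.le.trans (ENNReal.ofReal_le_ofReal (min_le_right _ _))) hF
  rw [mul_div_cancel_left₀ _ (half_pos hδ).ne'] at h1
  have hopen : MeasurableSet (φ ⁻¹' Metric.thickening δ F) :=
    φ.continuous.measurable Metric.isOpen_thickening.measurableSet
  have h2 : q.map Prod.swap {z | z.1 ∈ F ∧ c i z.2 z.1 < δ / 2} ≤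
      a' (φ ⁻¹' Metric.thickening δ F) + a' Kᶜ := by
    have hm : MeasurableSet {z : Y × X | z.1 ∈ F ∧ c i z.2 z.1 < δ / 2} :=
      (measurable_fst hF).inter
        (measurableSet_lt hci.flip.continuous.measurable measurable_const)
    rw [Measure.map_apply measurable_swap hm, ← hq.1, Measure.map_apply measurable_fst hopen,
      Measure.map_apply measurable_fst hK.measurableSet.compl]
    refine (measure_mono ?_).trans (measure_union_le _ _)
    rintro z ⟨hz1, hz2⟩
    by_cases hzK : z.1 ∈ K
    · refine Or.inl (Metric.mem_thickening_iff.2 ⟨z.2, hz1, ?_⟩)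
      have h3 := hci.dist_right z.1 (φ z.1) z.2
      have h4 := hiK z.1 hzK
      simp only [Prod.fst_swap, Prod.snd_swap] at hz2
      linarith
    · exact Or.inr hzK
  rw [Measure.map_apply φ.continuous.measurable Metric.isOpen_thickening.measurableSet]
  have h5 : ENNReal.ofReal ε = ENNReal.ofReal (ε / 5) + ENNReal.ofReal (ε / 5) +
      ENNReal.ofReal (ε / 5) + ENNReal.ofReal (ε / 5) + ENNReal.ofReal (ε / 5) := by
    rw [← ENNReal.ofReal_add, ← ENNReal.ofReal_add, ← ENNReal.ofReal_add, ← ENNReal.ofReal_add] <;>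
      first
      | positivity
      | ring_nf
  calc b F ≤ b' F + ENNReal.ofReal (ε / 5) := (hb F hF).trans (by gcongr)
    _ ≤ (a' (φ ⁻¹' Metric.thickening δ F) + a' Kᶜ + ENNReal.ofReal (ε / 5)) +
        ENNReal.ofReal (ε / 5) := by
      gcongr
      exact h1.trans (by gcongr)
    _ ≤ ((a (φ ⁻¹' Metric.thickening δ F) + ENNReal.ofReal (ε / 5)) +
        (ENNReal.ofReal (ε / 5) + ENNReal.ofReal (ε / 5)) + ENNReal.ofReal (ε / 5)) +
        ENNReal.ofReal (ε / 5) := by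
      gcongr
      · exact (ha _ hopen).trans (by gcongr)
      · exact (ha _ hK.measurableSet.compl).trans (by gcongr; exact hKa a rfl)
    _ = a (φ ⁻¹' Metric.thickening δ F) + ENNReal.ofReal ε := by
      rw [h5]; ring

/-- Letting `ε` and then `δ` tend to zero gives `b F ≤ a.map φ F` for closed `F`. This one-sided
bound suffices for probability measures: by portmanteau the constant sequence `b` converges weakly
to `a.map φ`, and weak limits are unique. -/
theorem map_eq_of_transportCost [CompleteSpace X] [SecondCountableTopology X]
    (hc : ∀ᶠ i in ω, IsCrossDist (c i)) (φ : X ≃ᵢ Y)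
    (hφ : ∀ x, Tendsto (fun i => c i x (φ x)) ω (𝓝 0)) {a : Measure X} {b : Measure Y}
    [IsProbabilityMeasure a] [IsProbabilityMeasure b]
    (h : ∀ ε : ℝ, 0 < ε → ∀ᶠ i in ω, ∃ (a' : Measure X) (b' : Measure Y),
      (∀ S, MeasurableSet S → a' S ≤ a S + ENNReal.ofReal ε) ∧
      (∀ S, MeasurableSet S → b S ≤ b' S + ENNReal.ofReal ε) ∧
      transportCost (c i) a' b' < ENNReal.ofReal ε) : a.map φ = b := by
  have : IsProbabilityMeasure (a.map φ) :=
    Measure.isProbabilityMeasure_map φ.continuous.measurable.aemeasurable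
  have hclosed : ∀ F : Set Y, IsClosed F → b F ≤ a.map φ F := by
    intro F hF
    refine ge_of_tendsto (tendsto_measure_thickening_of_isClosed
      ⟨1, one_pos, measure_ne_top _ _⟩ hF) ?_
    filter_upwards [self_mem_nhdsWithin] with δ hδ
    refine ENNReal.le_of_forall_pos_le_add fun ε hε _ => ?_
    simpa using measure_le_map_thickening hc φ hφ h hF.measurableSet hδ
      (NNReal.coe_pos.2 hε)
  let A : ProbabilityMeasure Y := ⟨a.map φ, this⟩
  let B : ProbabilityMeasure Y := ⟨b, inferInstance⟩
  have hlim : Tendsto (fun _ : ℕ => B) atTop (𝓝 A) := by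
    refine tendsto_of_forall_isOpen_le_liminf fun G hG => ?_
    rw [liminf_const]
    have h1 := hclosed Gᶜ hG.isClosed_compl
    have h2 : a.map φ G ≤ b G := by
      rw [prob_compl_eq_one_sub hG.measurableSet, prob_compl_eq_one_sub hG.measurableSet] at h1
      exact (ENNReal.sub_le_sub_iff_left prob_le_one ENNReal.one_ne_top).1 h1
    exact ENNReal.toNNReal_mono (measure_ne_top _ _) h2
  exact congrArg ProbabilityMeasure.toMeasure (tendsto_nhds_unique hlim tendsto_const_nhds)

end Ultralimit

/-- Pigeonhole: the ball has more mass than the pairs with `c ≥ η` and those with `G ≥ ε` can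
account for together. Measurability of `G` is not needed, since `G` is bounded below by a constant
on the measurable set `A`. -/
theorem IsCoupling.exists_mem_lt {X Y : Type*} [PseudoMetricSpace X] [MeasurableSpace X]
    [OpensMeasurableSpace X] [MeasurableSpace Y] {q : Measure (X × Y)} {μ : Measure X}
    {ν : Measure Y} (hq : IsCoupling q μ ν) {c : X → Y → ℝ}
    (hc : Measurable fun p : X × Y => c p.1 p.2) {G : X × Y → ℝ≥0∞} {r η ε : ℝ} (hη : 0 < η)
    (hε : 0 < ε) (hr : ∫⁻ z, ENNReal.ofReal (c z.1 z.2) ∂q ≤ ENNReal.ofReal r)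
    (hG : ∫⁻ z, G z ∂q ≤ ENNReal.ofReal r) {x : X}
    (hx : ENNReal.ofReal (r / ε) + ENNReal.ofReal (r / η) < μ (Metric.ball x η)) :
    ∃ z : X × Y, dist z.1 x < η ∧ c z.1 z.2 < η ∧ G z < ENNReal.ofReal ε := by
  by_contra! hcon
  set A : Set (X × Y) := {z | z.1 ∈ Metric.ball x η ∧ c z.1 z.2 < η}
  have hA : MeasurableSet A :=
    (measurable_fst measurableSet_ball).inter (measurableSet_lt hc measurable_const)
  have h1 : ENNReal.ofReal ε * q A ≤ ENNReal.ofReal r := by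
    rw [← setLIntegral_const]
    refine (setLIntegral_mono' hA fun z hz => ?_).trans ((setLIntegral_le_lintegral A G).trans hG)
    exact hcon z hz.1 hz.2
  have h2 : q A ≤ ENNReal.ofReal (r / ε) := by
    rw [ENNReal.ofReal_div_of_pos hε, ENNReal.le_div_iff_mul_le (by simp [hε]) (by simp), mul_comm]
    exact h1
  exact hx.not_ge ((hq.measure_le_add hc hη hr measurableSet_ball).trans (add_le_add h2 le_rfl))

/-! ### Regularity of the conjugate heat kernels -/

/-- The Gaussian density is at most `1`. -/
theorem abs_heatPhi_sub_le (a b : ℝ) : |heatPhi b - heatPhi a| ≤ |b - a| := by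
  have hint : Integrable fun y : ℝ => (√(4 * Real.pi))⁻¹ * Real.exp (-y ^ 2 / 4) := by
    refine Integrable.const_mul ?_ _
    convert! integrable_exp_neg_mul_sq (b := 1 / 4) (by norm_num) using 2 with y
    ring_nf
  have hpi : 1 ≤ √(4 * Real.pi) := Real.one_le_sqrt.2 (by linarith [Real.pi_gt_three])
  rw [heatPhi, heatPhi, intervalIntegral.integral_Iic_sub_Iic hint.integrableOn hint.integrableOn]
  have := intervalIntegral.norm_integral_le_of_norm_le_const (a := a) (b := b) (C := 1)
    (f := fun y : ℝ => (√(4 * Real.pi))⁻¹ * Real.exp (-y ^ 2 / 4)) fun y _ => by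
      rw [Real.norm_of_nonneg (by positivity)]
      refine mul_le_one₀ (inv_le_one_of_one_le₀ hpi) (Real.exp_pos _).le ?_
      exact Real.exp_le_one_iff.2 (by linarith [sq_nonneg y])
  simpa using this

instance {I : Set ℝ} (X : TimeSlicedSpace.{u} I) (t : ℝ) : SecondCountableTopology (X.Slice t) :=
  UniformSpace.secondCountable_of_separable _

namespace MetricFlow

variable {I : Set ℝ} (X : MetricFlow.{u} I) {s t : ℝ}

/-- The gradient property with `T = 0` applies to indicator functions; combined with the Lipschitz
bound for `heatPhi` it controls `ν h.le x S` uniformly in `S`, that is, in total variation. -/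
theorem ν_le_add (hs : s ∈ I) (ht : t ∈ I) (h : s < t) (x y : X.Slice t) {S : Set (X.Slice s)}
    (hS : MeasurableSet S) :
    X.ν h.le x S ≤ X.ν h.le y S + ENNReal.ofReal ((√(t - s))⁻¹ * dist x y) := by
  have hprob := X.ν_prob hs ht h.le
  have hx := hprob x
  have hy := hprob y
  have hu : ∀ x, ∫ z, S.indicator (fun _ => (1 : ℝ)) z ∂(X.ν h.le x) = (X.ν h.le x).real S :=
    fun x => by simp [integral_indicator hS]
  have hu01 : ∀ z, S.indicator (fun _ => (1 : ℝ)) z ∈ Icc (0 : ℝ) 1 := fun z => by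
    by_cases hz : z ∈ S <;> simp [hz]
  have key : (X.ν h.le x).real S ≤ (X.ν h.le y).real S + (√(t - s))⁻¹ * dist x y := by
    rcases X.gradient hs ht h 0 le_rfl (S.indicator fun _ => (1 : ℝ))
      (measurable_const.indicator hS) hu01 (fun h0 => absurd h0 (lt_irrefl 0))
      with ⟨c, hc⟩ | ⟨f, hf, hfu⟩
    · rw [← hu, ← hu, hc, hc]
      exact le_add_of_nonneg_right (by positivity)
    · rw [← hu, ← hu, hfu, hfu]
      have h1 := (le_abs_self _).trans (abs_heatPhi_sub_le (f y) (f x))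
      have h2 := hf.dist_le_mul x y
      rw [Real.dist_eq, add_zero, Real.coe_toNNReal _ (by positivity)] at h2
      linarith
  rw [← ofReal_measureReal (μ := X.ν h.le x), ← ofReal_measureReal (μ := X.ν h.le y),
    ← ENNReal.ofReal_add (by positivity) (by positivity)]
  exact ENNReal.ofReal_le_ofReal key

/-- The conjugate heat kernels as elements of the space of probability measures. -/
def νProb (hs : s ∈ I) (ht : t ∈ I) (h : s ≤ t) (x : X.Slice t) : ProbabilityMeasure (X.Slice s) :=
  ⟨X.ν h x, X.ν_prob hs ht h x⟩

theorem continuous_νProb (hs : s ∈ I) (ht : t ∈ I) (h : s ≤ t) : Continuous (X.νProb hs ht h) := by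
  rcases h.eq_or_lt with rfl | hlt
  -- At `s = t` there is no smoothing, and `x ↦ δ_x` is only weakly continuous.
  · have : X.νProb hs ht h = diracProba := funext fun x => Subtype.ext (X.ν_self hs x)
    exact this ▸ continuous_diracProba
  refine continuous_iff_continuousAt.2 fun x => tendsto_of_forall_isOpen_le_liminf fun G hG => ?_
  refine le_of_eq (Tendsto.liminf_eq ?_).symm
  rw [← NNReal.tendsto_coe]
  have hreal : ∀ y, ((X.νProb hs ht h y G : NNReal) : ℝ) = (X.ν h y).real G := fun y => rfl
  simp only [hreal]
  have hLip : LipschitzWith (Real.toNNReal (√(t - s))⁻¹) fun y => (X.ν h y).real G := by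
    refine LipschitzWith.of_le_add_mul _ fun y z => ?_
    have hy := X.ν_prob hs ht h y
    have hz := X.ν_prob hs ht h z
    have h1 := X.ν_le_add hs ht hlt y z hG.measurableSet
    rw [← ofReal_measureReal (μ := X.ν h y), ← ofReal_measureReal (μ := X.ν h z),
      ← ENNReal.ofReal_add (by positivity) (by positivity),
      ENNReal.ofReal_le_ofReal_iff (by positivity)] at h1
    rwa [Real.coe_toNNReal _ (by positivity)]
  exact hLip.continuous.tendsto x

theorem measurable_transportCost_ν {I' : Set ℝ} (X' : MetricFlow.{u} I') (hs : s ∈ I) (ht : t ∈ I)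
    (hs' : s ∈ I') (ht' : t ∈ I') (h : s ≤ t) {c : X.Slice s → X'.Slice s → ℝ}
    (hc : IsCrossDist c) :
    Measurable fun x : X.Slice t × X'.Slice t => transportCost c (X.ν h x.1) (X'.ν h x.2) :=
  LowerSemicontinuous.measurable <|
    (lowerSemicontinuous_transportCost hc.continuous hc.nonneg).comp
      (((X.continuous_νProb hs ht h).comp continuous_fst).prodMk
        ((X'.continuous_νProb hs' ht' h).comp continuous_snd))

end MetricFlow

/-! ### The `𝔽`-distance in terms of cross distances -/

/-- `r` is admissible in the definition of the `𝔽`-distance, for the correspondence that is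
encoded by some family of cross distances between the time-slices. -/
def IsCrossAdmissible {I : Set ℝ} (J : Set ℝ) (P₁ P₂ : MetricFlowPair.{u} I) (r : ℝ) : Prop :=
  ∃ E : Set ℝ, E ⊆ I ∧ NullMeasurableSet E volume ∧ J ⊆ I \ E ∧
    volume E ≤ ENNReal.ofReal (r ^ 2) ∧ I \ E ⊆ P₁.dom ∧ I \ E ⊆ P₂.dom ∧
    ∃ (c : ∀ t : ℝ, P₁.flow.Slice t → P₂.flow.Slice t → ℝ)
      (q : ∀ t : ℝ, Measure (P₁.flow.Slice t × P₂.flow.Slice t)),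
      (∀ t ∈ I \ E, IsCrossDist (c t)) ∧ (∀ t ∈ I \ E, IsCoupling (q t) (P₁.μ t) (P₂.μ t)) ∧
      ∀ s ∈ I \ E, ∀ t ∈ I \ E, ∀ h : s ≤ t,
        ∫⁻ x, transportCost (c s) (P₁.flow.ν h x.1) (P₂.flow.ν h x.2) ∂(q t) ≤ ENNReal.ofReal r

theorem Correspondence.wassersteinOne_map_map {I₁ I₂ I : Set ℝ} {X₁ : MetricFlow.{u} I₁}
    {X₂ : MetricFlow.{u} I₂} (C : Correspondence X₁ X₂ I) {s : ℝ} (h₁ : s ∈ C.dom₁)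
    (h₂ : s ∈ C.dom₂) (μ : Measure (X₁.Slice s)) (ν : Measure (X₂.Slice s)) :
    wassersteinOne (μ.map (C.φ₁ s h₁)) (ν.map (C.φ₂ s h₂)) =
      transportCost (fun x y => dist (C.φ₁ s h₁ x) (C.φ₂ s h₂ y)) μ ν :=
  _root_.wassersteinOne_map_map (C.isometry₁ s h₁) (C.isometry₂ s h₂) μ ν

theorem IsFAdmissible.isCrossAdmissible {I J : Set ℝ} {P₁ P₂ : MetricFlowPair.{u} I}
    {C : Correspondence P₁.flow P₂.flow I} {r : ℝ} (h : IsFAdmissible J P₁ P₂ C r) :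
    IsCrossAdmissible J P₁ P₂ r := by
  classical
  obtain ⟨E, hE, hEm, hJ, hvol, h₁, h₂, q, hq, hr⟩ := h
  have hex : ∀ t, ∃ c : P₁.flow.Slice t → P₂.flow.Slice t → ℝ, ∀ ht : t ∈ I \ E,
      c = fun x y => dist (C.φ₁ t (h₁ ht) x) (C.φ₂ t (h₂ ht) y) := by
    intro t
    by_cases ht : t ∈ I \ E
    · exact ⟨fun x y => dist (C.φ₁ t (h₁ ht) x) (C.φ₂ t (h₂ ht) y), fun _ => rfl⟩
    · exact ⟨fun _ _ => 0, fun ht' => absurd ht' ht⟩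
  choose c hc using hex
  refine ⟨E, hE, hEm, hJ, hvol, fun t ht => (C.dom₁_subset (h₁ ht)).1,
    fun t ht => (C.dom₂_subset (h₂ ht)).1, c, q, fun t ht => ?_, hq, fun s hs t ht hst => ?_⟩
  · rw [hc t ht]
    exact IsCrossDist.of_isometry (C.isometry₁ t _) (C.isometry₂ t _)
  · refine (lintegral_mono fun x => ?_).trans (hr s t hs ht hst)
    rw [hc s hs, C.wassersteinOne_map_map]

/-- Each cross distance is realised in its own space `Z t`, with embeddings defined exactly at the
times in `I \ E`; `J ⊆ I \ E` makes the correspondence fully defined. At other times `Z t` is a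
placeholder point. -/
theorem IsCrossAdmissible.exists_isFAdmissible {I J : Set ℝ} {P₁ P₂ : MetricFlowPair.{u} I} {r : ℝ}
    (h : IsCrossAdmissible J P₁ P₂ r) :
    ∃ C : Correspondence P₁.flow P₂.flow I, C.FullyDefined J ∧ IsFAdmissible J P₁ P₂ C r := by
  obtain ⟨E, hE, hEm, hJ, hvol, h₁, h₂, c, q, hc, hq, hr⟩ := h
  have hex : ∀ t, ∃ (Z : Type u) (_ : MetricSpace Z), t ∈ I \ E →
      ∃ (φ : P₁.flow.Slice t → Z) (ψ : P₂.flow.Slice t → Z),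
        Isometry φ ∧ Isometry ψ ∧ ∀ x y, dist (φ x) (ψ y) = c t x y := by
    intro t
    by_cases ht : t ∈ I \ E
    · obtain ⟨Z, m, hZ⟩ := (hc t ht).exists_isometry
      exact ⟨Z, m, fun _ => hZ⟩
    · exact ⟨PUnit, inferInstance, fun ht' => absurd ht' ht⟩
  choose Z m φ ψ hφ hψ hdist using hex
  let C : Correspondence P₁.flow P₂.flow I :=
    { Z := Z
      metric := m
      dom₁ := I \ E
      dom₂ := I \ E
      dom₁_subset := fun t ht => ⟨h₁ ht, ht.1⟩
      dom₂_subset := fun t ht => ⟨h₂ ht, ht.1⟩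
      φ₁ := φ
      φ₂ := ψ
      isometry₁ := hφ
      isometry₂ := hψ }
  refine ⟨C, ⟨hJ, hJ⟩, E, hE, hEm, hJ, hvol, subset_rfl, subset_rfl, q, hq,
    fun s t hs ht hst => (lintegral_mono fun x => le_of_eq ?_).trans (hr s hs t ht hst)⟩
  refine (C.wassersteinOne_map_map hs hs _ _).trans ?_
  congr 1
  funext x y
  exact hdist s hs x y

theorem FDist_eq_iInf {I : Set ℝ} (J : Set ℝ) (P₁ P₂ : MetricFlowPair.{u} I) :
    FDist J P₁ P₂ = ⨅ (r : ℝ) (_ : 0 < r) (_ : IsCrossAdmissible J P₁ P₂ r), ENNReal.ofReal r := by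
  refine le_antisymm (le_iInf fun r => le_iInf₂ fun hr h => ?_)
    (le_iInf₂ fun C _ => le_iInf fun r => le_iInf₂ fun hr h => ?_)
  · obtain ⟨C, hC, hCr⟩ := h.exists_isFAdmissible
    exact iInf_le_of_le C (iInf_le_of_le hC (iInf_le_of_le r (iInf_le_of_le hr
      (iInf_le_of_le hCr le_rfl))))
  · exact iInf_le_of_le r (iInf_le_of_le hr (iInf_le_of_le h.isCrossAdmissible le_rfl))

/-! ### Symmetry and the triangle inequality -/

theorem IsCrossAdmissible.FDist_le {I J : Set ℝ} {P₁ P₂ : MetricFlowPair.{u} I} {r : ℝ}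
    (hr : 0 < r) (h : IsCrossAdmissible J P₁ P₂ r) : FDist J P₁ P₂ ≤ ENNReal.ofReal r := by
  rw [FDist_eq_iInf]
  exact iInf_le_of_le r (iInf_le_of_le hr (iInf_le_of_le h le_rfl))

theorem IsCrossAdmissible.symm {I J : Set ℝ} {P₁ P₂ : MetricFlowPair.{u} I} {r : ℝ}
    (h : IsCrossAdmissible J P₁ P₂ r) : IsCrossAdmissible J P₂ P₁ r := by
  obtain ⟨E, hE, hEm, hJ, hvol, h₁, h₂, c, q, hc, hq, hr⟩ := h
  refine ⟨E, hE, hEm, hJ, hvol, h₂, h₁, fun t y x => c t x y, fun t => (q t).map Prod.swap,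
    fun t ht => (hc t ht).flip, fun t ht => (hq t ht).swap, fun s hs t ht hst => ?_⟩
  refine (lintegral_map_le _ _).trans ((lintegral_mono fun x => ?_).trans (hr s hs t ht hst))
  exact (transportCost_swap _ _ _).le

theorem FDist_comm {I : Set ℝ} (J : Set ℝ) (P₁ P₂ : MetricFlowPair.{u} I) :
    FDist J P₁ P₂ = FDist J P₂ P₁ := by
  simp only [FDist_eq_iInf]
  have : ∀ r, IsCrossAdmissible J P₁ P₂ r ↔ IsCrossAdmissible J P₂ P₁ r :=
    fun r => ⟨fun h => h.symm, fun h => h.symm⟩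
  simp only [this]

theorem IsCrossAdmissible.trans {I J : Set ℝ} {P₁ P₂ P₃ : MetricFlowPair.{u} I} {r r' : ℝ}
    (hr0 : 0 < r) (hr0' : 0 < r') (h : IsCrossAdmissible J P₁ P₂ r)
    (h' : IsCrossAdmissible J P₂ P₃ r') : IsCrossAdmissible J P₁ P₃ (r + r') := by
  obtain ⟨E, hE, hEm, hJ, hvol, h₁, h₂, c, q, hc, hq, hr⟩ := h
  obtain ⟨E', hE', hEm', hJ', hvol', h₂', h₃, c', q', hc', hq', hr'⟩ := h'
  have hsub : I \ (E ∪ E') ⊆ I \ E := sdiff_subset_sdiff_right subset_union_left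
  have hsub' : I \ (E ∪ E') ⊆ I \ E' := sdiff_subset_sdiff_right subset_union_right
  have hex : ∀ t, ∃ π : Measure ((P₁.flow.Slice t × P₂.flow.Slice t) × P₃.flow.Slice t),
      t ∈ I \ (E ∪ E') → π.map Prod.fst = q t ∧ π.map (fun p => (p.1.2, p.2)) = q' t := by
    intro t
    by_cases ht : t ∈ I \ (E ∪ E')
    · have := P₂.conj.prob t (h₂ (hsub ht))
      obtain ⟨π, hπ⟩ := (hq t (hsub ht)).exists_glue (hq' t (hsub' ht))
      exact ⟨π, fun _ => hπ⟩
    · exact ⟨0, fun ht' => absurd ht' ht⟩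
  choose π hπ using hex
  have hcross : ∀ t ∈ I \ (E ∪ E'), IsCrossDist fun x z => ⨅ y, (c t x y + c' t y z) := by
    intro t ht
    have := P₂.conj.prob t (h₂ (hsub ht))
    have : Nonempty (P₂.flow.Slice t) := nonempty_of_isProbabilityMeasure (P₂.μ t)
    exact (hc t (hsub ht)).iInf_add (hc' t (hsub' ht))
  refine ⟨E ∪ E', union_subset hE hE', hEm.union hEm', fun t ht => ⟨(hJ ht).1, ?_⟩, ?_,
    hsub.trans h₁, hsub'.trans h₃, _, fun t => (π t).map fun p => (p.1.1, p.2), hcross,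
    fun t ht => ?_, fun s hs t ht hst => ?_⟩
  · rintro (h | h)
    exacts [(hJ ht).2 h, (hJ' ht).2 h]
  · refine (measure_union_le _ _).trans ((add_le_add hvol hvol').trans ?_)
    rw [← ENNReal.ofReal_add (by positivity) (by positivity)]
    -- `r² + r'² ≤ (r + r')²`, which is why the exceptional set may be as large as `E ∪ E'`.
    exact ENNReal.ofReal_le_ofReal (by nlinarith)
  · obtain ⟨e, e'⟩ := hπ t ht
    constructor
    · rw [← (hq t (hsub ht)).1, ← e, Measure.map_map (by fun_prop) (by fun_prop),
        Measure.map_map (by fun_prop) (by fun_prop)]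
      rfl
    · rw [← (hq' t (hsub' ht)).2, ← e', Measure.map_map (by fun_prop) (by fun_prop),
        Measure.map_map (by fun_prop) (by fun_prop)]
      rfl
  · obtain ⟨e, e'⟩ := hπ t ht
    have m := P₁.flow.measurable_transportCost_ν P₂.flow (h₁ (hsub hs)) (h₁ (hsub ht))
      (h₂ (hsub hs)) (h₂ (hsub ht)) hst (hc s (hsub hs))
    have m' := P₂.flow.measurable_transportCost_ν P₃.flow (h₂ (hsub hs)) (h₂ (hsub ht))
      (h₃ (hsub' hs)) (h₃ (hsub' ht)) hst (hc' s (hsub' hs))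
    have i := hr s (hsub hs) t (hsub ht) hst
    have i' := hr' s (hsub' hs) t (hsub' ht) hst
    rw [← e, lintegral_map m measurable_fst] at i
    rw [← e', lintegral_map m' (by fun_prop)] at i'
    rw [ENNReal.ofReal_add hr0.le hr0'.le]
    refine (lintegral_map_le _ _).trans (le_trans ?_ (add_le_add i i'))
    have m₁ : Measurable fun p : (P₁.flow.Slice t × P₂.flow.Slice t) × P₃.flow.Slice t =>
        transportCost (c s) (P₁.flow.ν hst p.1.1) (P₂.flow.ν hst p.1.2) := m.comp measurable_fst
    rw [← lintegral_add_left m₁]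
    refine lintegral_mono fun p => ?_
    have := P₂.flow.ν_prob (h₂ (hsub hs)) (h₂ (hsub ht)) hst p.1.2
    refine transportCost_triangle (hc s (hsub hs)).continuous.measurable
      (hc' s (hsub' hs)).continuous.measurable fun x y z => ?_
    exact ciInf_le ⟨0, forall_mem_range.2 fun y => add_nonneg ((hc s (hsub hs)).nonneg _ _)
      ((hc' s (hsub' hs)).nonneg _ _)⟩ y

theorem FDist_triangle {I : Set ℝ} (J : Set ℝ) (P₁ P₂ P₃ : MetricFlowPair.{u} I) :
    FDist J P₁ P₃ ≤ FDist J P₁ P₂ + FDist J P₂ P₃ := by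
  rw [FDist_eq_iInf J P₁ P₂, FDist_eq_iInf J P₂ P₃]
  simp only [ENNReal.iInf_add, ENNReal.add_iInf]
  refine le_iInf fun r' => le_iInf₂ fun hr' h' => le_iInf fun r => le_iInf₂ fun hr h => ?_
  rw [← ENNReal.ofReal_add hr.le hr'.le]
  exact (h.trans hr hr' h').FDist_le (by positivity)

/-! ### Vanishing distance and almost always isometries -/

theorem AlmostAlwaysIsometric.FDist_eq_zero {I J : Set ℝ} {P₁ P₂ : MetricFlowPair.{u} I}
    (h : AlmostAlwaysIsometric J P₁ P₂) : FDist J P₁ P₂ = 0 := by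
  obtain ⟨I', hI', h₁, -, hJ, φ, hν, hμ⟩ := h
  have hI'I : I' ⊆ I := fun t ht => P₁.dom_subset (hI' ht).1
  have hdiff : I \ (I \ I') = I' := sdiff_sdiff_cancel_left hI'I
  have hnull : volume (I \ I') = 0 := by
    refine measure_mono_null (fun t ht => ?_) (measure_union_null P₁.volume_diff h₁)
    by_cases htd : t ∈ P₁.dom
    exacts [Or.inr ⟨htd, ht.2⟩, Or.inl ⟨ht.1, htd⟩]
  have hex : ∀ t, ∃ c : P₁.flow.Slice t → P₂.flow.Slice t → ℝ, ∀ ht : t ∈ I',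
      c = fun x y => dist (φ t ht x) y := by
    intro t
    by_cases ht : t ∈ I'
    · exact ⟨fun x y => dist (φ t ht x) y, fun _ => rfl⟩
    · exact ⟨fun _ _ => 0, fun ht' => absurd ht' ht⟩
  choose c hc using hex
  have hex' : ∀ t, ∃ q : Measure (P₁.flow.Slice t × P₂.flow.Slice t), ∀ ht : t ∈ I',
      q = (P₁.μ t).map fun x => (x, φ t ht x) := by
    intro t
    by_cases ht : t ∈ I'
    · exact ⟨(P₁.μ t).map fun x => (x, φ t ht x), fun _ => rfl⟩
    · exact ⟨0, fun ht' => absurd ht' ht⟩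
  choose q hq using hex'
  -- With `E = I \ I'`, which is null, the cross distance `dist (φ t x) y` and the graph coupling
  -- make every integral zero.
  have hadm : ∀ r : ℝ, IsCrossAdmissible J P₁ P₂ r := by
    intro r
    refine ⟨I \ I', sdiff_subset, NullMeasurableSet.of_null hnull, hdiff.symm ▸ hJ,
      hnull.trans_le zero_le, ?_⟩
    rw [hdiff]
    refine ⟨fun t ht => (hI' ht).1, fun t ht => (hI' ht).2, c, q, fun t ht => ?_, fun t ht => ?_,
      fun s hs t ht hst => ?_⟩
    · rw [hc t ht]
      exact IsCrossDist.of_isometry (φ t ht).isometry isometry_id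
    · rw [hq t ht, ← hμ t ht]
      exact isCoupling_map_graph _ (φ t ht).continuous.measurable
    · rw [hq t ht]
      refine (lintegral_map_le _ _).trans ?_
      have : ∀ x, transportCost (c s) (P₁.flow.ν hst x) (P₂.flow.ν hst (φ t ht x)) = 0 := by
        intro x
        rw [← hν s t hs ht hst x]
        refine transportCost_map_eq_zero _ (φ s hs).continuous.measurable fun y => ?_
        simp [hc s hs]
      simp [this]
  refine le_antisymm (ENNReal.le_of_forall_pos_le_add fun ε hε _ => ?_) zero_le
  rw [zero_add, ← ENNReal.ofReal_coe_nnreal]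
  exact (hadm ε).FDist_le hε

theorem almostAlwaysIsometric_of_FDist_eq_zero {I J : Set ℝ} {P₁ P₂ : MetricFlowPair.{u} I}
    (h : FDist J P₁ P₂ = 0) : AlmostAlwaysIsometric J P₁ P₂ := by
  have hex : ∀ n : ℕ, ∃ r : ℝ, 0 < r ∧ r < (1 / 2) ^ n ∧ IsCrossAdmissible J P₁ P₂ r := by
    intro n
    have hn : FDist J P₁ P₂ < ENNReal.ofReal ((1 / 2) ^ n) := by
      rw [h]; simp
    simp only [FDist_eq_iInf, iInf_lt_iff] at hn
    obtain ⟨r, hr, hadm, hlt⟩ := hn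
    exact ⟨r, hr, (ENNReal.ofReal_lt_ofReal_iff (by positivity)).1 hlt, hadm⟩
  choose r hr0 hr E hE hEm hJ hvol h₁ h₂ c q hc hq hint using hex
  -- One ultrafilter serves all times, so `φ s` and `φ t` are limits along the same indices and can
  -- be compared.
  let ω : Ultrafilter ℕ := hyperfilter ℕ
  have hω : (ω : Filter ℕ) ≤ atTop := Nat.hyperfilter_le_atTop
  have hrlim : Tendsto r ω (𝓝 0) := by
    refine Tendsto.mono_left ?_ hω
    exact squeeze_zero (fun n => (hr0 n).le) (fun n => (hr n).le)
      (tendsto_pow_atTop_nhds_zero_of_lt_one (by norm_num) (by norm_num))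
  set I' : Set ℝ := {t | ∀ᶠ n in ω, t ∈ I \ E n} with hI'_def
  -- Borel–Cantelli: `volume (E n) ≤ (r n)² ≤ 2⁻ⁿ` is summable, and a time of `I` in only finitely
  -- many `E n` belongs to `I'`.
  have hnull : volume (I \ I') = 0 := by
    have hsum : ∑' n, volume (E n) ≠ ∞ := by
      have hs : Summable fun n : ℕ => ((1 : ℝ) / 2) ^ n := summable_geometric_two
      refine ne_top_of_le_ne_top (hs.tsum_ofReal_ne_top) (ENNReal.tsum_le_tsum fun n => ?_)
      refine (hvol n).trans (ENNReal.ofReal_le_ofReal ?_)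
      have h1 : ((1 : ℝ) / 2) ^ n ≤ 1 := pow_le_one₀ (by norm_num) (by norm_num)
      nlinarith [hr n, hr0 n]
    refine measure_mono_null (fun t ht => ?_) (measure_limsup_atTop_eq_zero hsum)
    by_contra hcon
    rw [limsup_eq_iInf_iSup_of_nat] at hcon
    simp only [iInf_eq_iInter, iSup_eq_iUnion, mem_iInter, mem_iUnion, not_forall,
      not_exists] at hcon
    obtain ⟨N, hN⟩ := hcon
    refine ht.2 (hω ?_)
    filter_upwards [eventually_ge_atTop N] with n hn
    exact ⟨ht.1, hN n hn⟩
  have hdom : ∀ {t}, t ∈ I' → t ∈ P₁.dom ∩ P₂.dom := by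
    intro t ht
    obtain ⟨n, hn⟩ := Eventually.exists ht
    exact ⟨h₁ n hn, h₂ n hn⟩
  have hcross : ∀ {t}, t ∈ I' → ∀ᶠ n in ω, IsCrossDist (c n t) := fun {t} ht =>
    Eventually.mono ht fun n hn => hc n t hn
  -- At `s = t` the kernels are Dirac masses, so the 𝔽-bound controls the cost of `q n t` itself.
  have hself : ∀ {t} n, t ∈ I \ E n → ∫⁻ x, ENNReal.ofReal (c n t x.1 x.2) ∂(q n t) ≤
      ENNReal.ofReal (r n) := by
    intro t n ht
    refine le_trans (le_of_eq (lintegral_congr fun x => ?_)) (hint n t ht t ht le_rfl)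
    rw [P₁.flow.ν_self (h₁ n ht), P₂.flow.ν_self (h₂ n ht), transportCost_dirac_dirac]
  have hcost : ∀ {t}, t ∈ I' → ∀ ε : ℝ, 0 < ε →
      ∀ᶠ n in ω, transportCost (c n t) (P₁.μ t) (P₂.μ t) < ENNReal.ofReal ε := by
    intro t ht ε hε
    filter_upwards [ht, hrlim.eventually_lt_const hε] with n hn hrn
    exact ((transportCost_le (hq n t hn)).trans (hself n hn)).trans_lt
      ((ENNReal.ofReal_lt_ofReal_iff hε).2 hrn)
  have hφ : ∀ t, t ∈ I' → ∃ φ : P₁.flow.Slice t ≃ᵢ P₂.flow.Slice t,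
      ∀ x, Tendsto (fun n => c n t x (φ x)) ω (𝓝 0) := by
    intro t ht
    have := P₁.conj.prob t (hdom ht).1
    have := P₂.conj.prob t (hdom ht).2
    refine exists_isometryEquiv_of_exists_tendsto_zero (hcross ht)
      (exists_tendsto_zero_of_transportCost (hcross ht) (P₁.support_eq t (hdom ht).1) (hcost ht))
      (exists_tendsto_zero_of_transportCost (c := fun n y x => c n t x y) (μ := P₂.μ t)
        (ν := P₁.μ t) ((hcross ht).mono fun n hn => hn.flip) (P₂.support_eq t (hdom ht).2)
        fun ε hε => ?_)
    filter_upwards [hcost ht ε hε] with n hn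
    rwa [transportCost_swap]
  choose φ hφ using hφ
  refine ⟨I', fun t ht => hdom ht,
    measure_mono_null (sdiff_subset_sdiff_left P₁.dom_subset) hnull,
    measure_mono_null (sdiff_subset_sdiff_left P₂.dom_subset) hnull,
    fun t ht => Eventually.of_forall fun n => hJ n ht, φ, fun s t hs ht hst x => ?_,
    fun t ht => ?_⟩
  · rcases hst.eq_or_lt with rfl | hlt
    · rw [P₁.flow.ν_self (hdom hs).1, P₂.flow.ν_self (hdom hs).2,
        Measure.map_dirac' (φ s hs).continuous.measurable]
    have := P₁.flow.ν_prob (hdom hs).1 (hdom ht).1 hst x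
    have := P₂.flow.ν_prob (hdom hs).2 (hdom ht).2 hst (φ t ht x)
    refine map_eq_of_transportCost (hcross hs) (φ s hs) (hφ s hs) fun ε hε => ?_
    set L : ℝ := (√(t - s))⁻¹ with hL
    have hL0 : 0 < L := inv_pos.2 (Real.sqrt_pos.2 (sub_pos.2 hlt))
    -- A pair `z` with `dist z.1 x < η` and `c n t z.1 z.2 < η` will satisfy `dist (φ t x) z.2 ≤ 3 *
    -- η`, the third `η` coming from `c n t x (φ t x)`. The kernels, which are `L`-Lipschitz in
    -- total variation, then change by at most `ε`.
    set η : ℝ := ε / L / 3 with hη_def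
    have hη : 0 < η := by positivity
    have hη3 : L * (3 * η) = ε := by rw [hη_def]; field_simp
    have hpos := measure_ball_pos_of_support_eq_univ (P₁.support_eq t (hdom ht).1) x hη
    have hsmall : Tendsto (fun n => ENNReal.ofReal (r n / ε) + ENNReal.ofReal (r n / η)) ω
        (𝓝 0) := by
      have h1 := ENNReal.tendsto_ofReal (hrlim.div_const ε)
      have h2 := ENNReal.tendsto_ofReal (hrlim.div_const η)
      simpa using h1.add h2
    filter_upwards [hs, ht, hsmall.eventually_lt_const hpos,
      (hφ t ht x).eventually_lt_const hη] with n hns hnt hn hnφ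
    obtain ⟨z, hz1, hz2, hz3⟩ := (hq n t hnt).exists_mem_lt (hc n t hnt).continuous.measurable hη
      hε (hself n hnt) (hint n s hns t hnt hst) hn
    -- The auxiliary measures are the kernels based at `z.1` and `z.2`, whose transport cost is
    -- below `ε` by `hz3`.
    refine ⟨_, _, fun S hS => ?_, fun S hS => ?_, hz3⟩
    · refine (P₁.flow.ν_le_add (hdom hs).1 (hdom ht).1 hlt z.1 x hS).trans ?_
      gcongr
      nlinarith
    · refine (P₂.flow.ν_le_add (hdom hs).2 (hdom ht).2 hlt (φ t ht x) z.2 hS).trans ?_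
      gcongr
      have h3 := (hc n t hnt).dist_right x (φ t ht x) z.2
      have h4 := (hc n t hnt).le_left x z.1 z.2
      rw [dist_comm] at hz1
      have h5 : dist (φ t ht x) z.2 ≤ 3 * η := by linarith
      rw [← hη3]
      gcongr
  · have := P₁.conj.prob t (hdom ht).1
    have := P₂.conj.prob t (hdom ht).2
    refine map_eq_of_transportCost (hcross ht) (φ t ht) (hφ t ht) fun ε hε => ?_
    filter_upwards [hcost ht ε hε] with n hn
    exact ⟨_, _, fun S _ => le_self_add, fun S _ => le_self_add, hn⟩

theorem FDist_le_of_almostAlwaysIsometric {I J : Set ℝ} {P P' Q Q' : MetricFlowPair.{u} I}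
    (hP : AlmostAlwaysIsometric J P P') (hQ : AlmostAlwaysIsometric J Q Q') :
    FDist J P Q ≤ FDist J P' Q' :=
  calc FDist J P Q ≤ FDist J P P' + (FDist J P' Q' + FDist J Q' Q) :=
        (FDist_triangle J P P' Q).trans (add_le_add le_rfl (FDist_triangle J P' Q' Q))
    _ = FDist J P' Q' := by rw [hP.FDist_eq_zero, hQ.symm.FDist_eq_zero, zero_add, add_zero]

end

theorem theorem5 (I J : Set ℝ) (hI : I.OrdConnected) (hJ : J ⊆ I) :
    ∃ m : EMetricSpace (FSpace.{u} I J), ∀ P Q : FullyDefinedPair.{u} I J,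
      m.edist (FSpace.mk P) (FSpace.mk Q) = FDist J P.1 Q.1 := by
  let d : FSpace.{u} I J → FSpace.{u} I J → ℝ≥0∞ :=
    Quotient.lift₂ (fun P Q => FDist J P.1 Q.1) fun P Q P' Q' hP hQ =>
      (FDist_le_of_almostAlwaysIsometric hP hQ).antisymm
        (FDist_le_of_almostAlwaysIsometric hP.symm hQ.symm)
  refine ⟨{ edist := d, edist_self := ?_, edist_comm := ?_, edist_triangle := ?_,
            eq_of_edist_eq_zero := ?_ }, fun P Q => rfl⟩
  · rintro ⟨P⟩
    exact (AlmostAlwaysIsometric.refl P.1 P.2).FDist_eq_zero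
  · rintro ⟨P⟩ ⟨Q⟩
    exact FDist_comm J P.1 Q.1
  · rintro ⟨P⟩ ⟨Q⟩ ⟨R⟩
    exact FDist_triangle J P.1 Q.1 R.1
  · rintro ⟨P⟩ ⟨Q⟩ h
    exact Quotient.sound (almostAlwaysIsometric_of_FDist_eq_zero h)
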